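/- **Setting.** An instance of the $1$-$B$-knapsack problem ($B\ge 2$ an integer) consists of $n$ items with values $v_1>v_2>\dots>v_n\ge 0$ and sizes $s_1,\dots,s_n\in\{1,B\}$. A packing is a set of items of total size at most $B$, and $\mathsf{OPT}$ is a packing of maximum total value $v(\mathsf{OPT})$. The items arrive one by one in uniformly random order. An ordinal algorithm knows $B$ and $n$; upon each arrival it must irrevocably accept or reject the arriving item, based only on the sizes of the items that have arrived so far, the relative order of their values, and its internal randomness; the set of accepted items must always be a packing. For fixed $B$ and $n$, an algorithm $\mathsf{ALG}$ is $\rho$-competitive if $\mathbb{E}[v(\mathsf{ALG})]\ge\rho\cdot v(\mathsf{OPT})$ for every instance with $n$ items and capacity $B$, where the expectation is over the arrival order and the internal randomness. **Theorem.** (i) There are ordinal algorithms $\mathsf{ALG}_{B,n}$ and a function $\delta$ with $\delta(B)\to0$ as $B\to\infty$ such that, for all $B\ge2$ and all $n$, $\mathsf{ALG}_{B,n}$ is $\left(\frac1{e+1}-\delta(B)\right)$-competitive. (ii) There is a function $\delta'$ with $\delta'(B)\to0$ as $B\to\infty$ such that, for all $B\ge2$ and all $n\ge2B$, every ordinal algorithm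 for capacity $B$ and $n$ items that is $\rho$-competitive satisfies $\rho\le\frac1{e+1}+\delta'(B)$. -/

import Mathlib

/-! ## The 1-B-knapsack secretary problem and ordinal algorithms -/

namespace KnapsackSecretary

/-- An instance of 1-B-knapsack with `n` items and capacity `B`. Items are named by their global
rank: the values are non-negative and strictly decreasing, and item `0` is the most valuable one.
Large items have size `B`, small items have size `1`. -/
structure Inst (B n : ℕ) where
  value : Fin n → ℝ
  value_nonneg : ∀ i, 0 ≤ value i
  value_strictAnti : StrictAnti value
  isLarge : Fin n → Bool

variable {B n : ℕ}

/-- The size of an item: `B` if it is large, `1` if it is small. -/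
def Inst.size (I : Inst B n) (i : Fin n) : ℕ := if I.isLarge i then B else 1

/-- A set of items is feasible (a packing) if its total size is at most the capacity `B`. -/
def Inst.Feasible (I : Inst B n) (S : Finset (Fin n)) : Prop := ∑ i ∈ S, I.size i ≤ B

/-- The total value of a set of items. -/
def Inst.totalValue (I : Inst B n) (S : Finset (Fin n)) : ℝ := ∑ i ∈ S, I.value i

/-- The empty packing is feasible. -/
theorem Inst.feasible_empty (I : Inst B n) : I.Feasible ∅ := by
  simp [Inst.Feasible]

open Classical in
/-- The value of an optimal offline packing: the maximum total value of a feasible set. -/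
noncomputable def Inst.opt (I : Inst B n) : ℝ :=
  (Finset.univ.filter I.Feasible).sup' ⟨∅, by simp [I.feasible_empty]⟩ I.totalValue

/-- An arrival order: `σ t` is the item that arrives in round `t`. -/
abbrev ArrivalOrder (n : ℕ) := Equiv.Perm (Fin n)

/-- What an ordinal algorithm knows after `m` arrivals: the size type of each arrived item, and for
each pair of arrived items, which one is more valuable. Items are referred to by arrival time. -/
structure OrdinalView (m : ℕ) where
  isLarge : Fin m → Bool
  better : Fin m → Fin m → Bool

open Classical in
/-- The ordinal information available in round `t` (when the `t`-th item has just arrived, rounds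
being counted from `0`) on instance `I` under the arrival order `σ`. -/
noncomputable def Inst.view (I : Inst B n) (σ : ArrivalOrder n) (t : Fin n) :
    OrdinalView (t + 1) where
  isLarge j := I.isLarge (σ (Fin.castLE t.isLt j))
  better i j := decide (I.value (σ (Fin.castLE t.isLt j)) < I.value (σ (Fin.castLE t.isLt i)))

/-- A rule that decides in each round, from the ordinal information available in that round,
whether to accept the item that has just arrived. -/
abbrev DecisionRule (n : ℕ) := (t : Fin n) → OrdinalView (t + 1) → Bool

/-- The set of items accepted by a decision rule. -/
noncomputable def DecisionRule.accepted (d : DecisionRule n) (I : Inst B n) (σ : ArrivalOrder n) :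
    Finset (Fin n) :=
  Finset.univ.filter fun i => d (σ.symm i) (I.view σ (σ.symm i)) = true

/-- A deterministic ordinal algorithm for capacity `B` and `n` items (both of which it knows): a
decision rule whose accepted set is always a packing. -/
def DetAlgorithm (B n : ℕ) : Type :=
  { d : DecisionRule n // ∀ (I : Inst B n) (σ : ArrivalOrder n), I.Feasible (d.accepted I σ) }

/-- There are finitely many ordinal views after `m` arrivals. -/
instance OrdinalView.instFinite (m : ℕ) : Finite (OrdinalView m) :=
  Finite.of_injective
    (fun w : OrdinalView m => (w.isLarge, w.better))
    (by
      rintro ⟨a, b⟩ ⟨c, d⟩ h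
      simpa using h)

/-- There are finitely many deterministic ordinal algorithms for given `B` and `n`. -/
noncomputable instance DetAlgorithm.instFintype (B n : ℕ) : Fintype (DetAlgorithm B n) :=
  haveI : Finite (DetAlgorithm B n) := Subtype.finite
  Fintype.ofFinite _

/-- A (randomized) ordinal algorithm for capacity `B` and `n` items: a probability distribution
over the finitely many deterministic ones. -/
abbrev OrdinalAlgorithm (B n : ℕ) : Type := PMF (DetAlgorithm B n)

/-- The expected value of the packing of a randomized ordinal algorithm, over its internal
randomization and an independent, uniformly random arrival order. -/
noncomputable def OrdinalAlgorithm.expectedValue (A : OrdinalAlgorithm B n) (I : Inst B n) : ℝ :=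
  ∑ d : DetAlgorithm B n, (A d).toReal *
    ((∑ σ : ArrivalOrder n, I.totalValue (d.1.accepted I σ)) /
      (Fintype.card (ArrivalOrder n) : ℝ))

/-- The algorithm obtains in expectation at least `ρ` times the optimal value, on every instance
with `n` items and capacity `B`. -/
def OrdinalAlgorithm.IsCompetitive (A : OrdinalAlgorithm B n) (ρ : ℝ) : Prop :=
  ∀ I : Inst B n, ρ * I.opt ≤ A.expectedValue I

end KnapsackSecretary

/-!
# The 1-B-knapsack secretary problem: the optimal ordinal ratio is `1 / (e + 1)` as `B → ∞`

**Lower bound.** An optimal packing is either the best large item or the best (at most) `B` small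
items (`opt_cases`). With probability `e / (e + 1)` the algorithm ignores the small items and runs
the classical secretary algorithm on the large ones. The number of large items is unknown, so the
sample is a fixed fraction of all `n` rounds; success has probability at least `1 / e` for *every*
`n`, without an error term (`exists_large_algorithm`). With probability `1 / (e + 1)` it ignores the
large items: it samples a fraction of about `B ^ (-1/4)` of the rounds and then accepts the small
items that are beaten by few small items of the sample. The number of sampled items among the best
small ones has variance at most its mean (`expect_sq_sample_le`), so Chebyshev's inequality shows
that a fraction `1 - O(B ^ (-1/4))` of the optimal value is obtained (`exists_small_algorithm`).

**Upper bound.** Take `B` small items and `L = n - B ≥ B` large ones, all large items being better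
than all small ones. If item `0` carries all of the value, only accepting item `0` counts; if all
values are about equal, only the number of small items counts. Both instances have the same ordinal
structure, so it suffices to bound, for a deterministic algorithm,
`e · P(item 0 accepted) + E(number of small items accepted) / B` by `1 + o(1)` (`tradeoff`); the
competitive ratio `ρ` then satisfies `e ρ + ρ ≤ 1 + o(1)`.

For that bound, while nothing has been accepted and `l` large and `s` small items have been seen,
the future gain is at most the potential `pot l s`. Its main part is the value function of the
secretary problem in continuous time, scaled by `e`: it equals `1` for `x ≤ 1 / e` and `-e x log x`
for `x ≥ 1 / e`, where `x = l / L`. It dominates `1 - x`, which is what is gained by turning to the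
small items if small and large items arrive in proportion. Deviations from proportionality are paid
for by a quadratic supermartingale (`quadPot`), whose initial value is `O(1 / B)`. That the
potential is a supermartingale along the algorithm (`expect_gain_succ_le`) rests on two facts about
the next arrival given the ordinal past: it is large with probability equal to the proportion of
large items still to come (`expect_mul_ind_large`), and, if large, it beats the `l` large items seen
with probability `1 / (l + 1)` (`expect_mul_ind_record`). Both are proved by measure-preserving
exchanges of arrival orders that leave the ordinal past unchanged: exchanging two future rounds,
respectively exchanging the newest item with a neighbour in the order of the arrived items.
-/

open scoped BigOperators

namespace KnapsackSecretary

variable {B n : ℕ}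

/-! ### Indicators and averages over arrival orders -/

open Classical in
/-- The real-valued indicator of a proposition. -/
noncomputable def ind (p : Prop) : ℝ := if p then 1 else 0

theorem ind_true {p : Prop} (h : p) : ind p = 1 := if_pos h

theorem ind_false {p : Prop} (h : ¬ p) : ind p = 0 := if_neg h

theorem ind_nonneg (p : Prop) : 0 ≤ ind p := by
  unfold ind; split_ifs <;> norm_num

theorem ind_le_one (p : Prop) : ind p ≤ 1 := by
  unfold ind; split_ifs <;> norm_num

theorem ind_not (p : Prop) : ind (¬ p) = 1 - ind p := by
  by_cases h : p <;> simp [ind, h]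

theorem ind_and (p q : Prop) : ind (p ∧ q) = ind p * ind q := by
  by_cases h : p <;> by_cases h' : q <;> simp [ind, h, h']

theorem ind_mono {p q : Prop} (h : p → q) : ind p ≤ ind q := by
  by_cases hp : p
  · rw [ind_true hp, ind_true (h hp)]
  · rw [ind_false hp]; exact ind_nonneg q

theorem sum_ind {α : Type*} (s : Finset α) (p : α → Prop) [DecidablePred p] :
    ∑ i ∈ s, ind (p i) = ((s.filter p).card : ℝ) := by
  rw [Finset.card_filter]
  push_cast
  exact Finset.sum_congr rfl fun i _ => by unfold ind; congr

theorem expect_mul_right (τ : Equiv.Perm (Fin n)) (f : Equiv.Perm (Fin n) → ℝ) :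
    𝔼 σ, f (σ * τ) = 𝔼 σ, f σ :=
  Fintype.expect_equiv (Equiv.mulRight τ) _ _ fun _ => rfl

theorem expect_mul_left (τ : Equiv.Perm (Fin n)) (f : Equiv.Perm (Fin n) → ℝ) :
    𝔼 σ, f (τ * σ) = 𝔼 σ, f σ :=
  Fintype.expect_equiv (Equiv.mulLeft τ) _ _ fun _ => rfl

theorem expect_mono {f g : Equiv.Perm (Fin n) → ℝ} (h : ∀ σ, f σ ≤ g σ) :
    𝔼 σ, f σ ≤ 𝔼 σ, g σ :=
  Finset.expect_le_expect fun σ _ => h σ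

theorem expect_nonneg {f : Equiv.Perm (Fin n) → ℝ} (h : ∀ σ, 0 ≤ f σ) : 0 ≤ 𝔼 σ, f σ :=
  Finset.expect_nonneg fun σ _ => h σ

/-- A fixed round is equally likely to receive each item. -/
theorem expect_ind_apply_eq (t b : Fin n) :
    𝔼 σ : Equiv.Perm (Fin n), ind (σ t = b) = 1 / n := by
  have h : ∀ c, 𝔼 σ : Equiv.Perm (Fin n), ind (σ t = c)
      = 𝔼 σ : Equiv.Perm (Fin n), ind (σ t = b) := by
    intro c
    rw [← expect_mul_left (Equiv.swap b c) fun σ => ind (σ t = c)]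
    refine Finset.expect_congr rfl fun σ _ => ?_
    congr 1
    rw [Equiv.Perm.mul_apply, ← Equiv.eq_symm_apply, Equiv.symm_swap, Equiv.swap_apply_right]
  have hs : ∑ c, 𝔼 σ : Equiv.Perm (Fin n), ind (σ t = c) = 1 := by
    rw [← Finset.expect_sum_comm]
    rw [← Fintype.expect_const (ι := Equiv.Perm (Fin n)) (1 : ℝ)]
    refine Finset.expect_congr rfl fun σ _ => ?_
    rw [sum_ind, Finset.filter_eq]
    simp
  simp only [h, Finset.sum_const, Finset.card_univ, Fintype.card_fin, nsmul_eq_mul] at hs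
  have : (n : ℝ) ≠ 0 := by
    have := t.pos
    positivity
  field_simp
  linarith

theorem card_filter_val_lt {k : ℕ} (hk : k ≤ n) :
    (Finset.univ.filter fun t : Fin n => (t : ℕ) < k).card = k := by
  rw [Fin.card_filter_val_lt, min_eq_right hk]

/-- Each item arrives in the first `k` rounds with probability `k / n`. -/
theorem expect_ind_symm_lt {k : ℕ} (hk : k ≤ n) (i : Fin n) :
    𝔼 σ : Equiv.Perm (Fin n), ind ((σ.symm i : ℕ) < k) = k / n := by
  have h : ∀ σ : Equiv.Perm (Fin n), ind ((σ.symm i : ℕ) < k) =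
      ∑ t ∈ Finset.univ.filter (fun t : Fin n => (t : ℕ) < k), ind (σ t = i) := by
    intro σ
    by_cases hi : (σ.symm i : ℕ) < k
    · rw [ind_true hi, Finset.sum_eq_single_of_mem (σ.symm i) (by simpa using hi)]
      · rw [ind_true (by simp)]
      · intro t _ ht
        exact ind_false fun h => ht (by rw [← h]; simp)
    · rw [ind_false hi, Finset.sum_eq_zero]
      intro t ht
      refine ind_false fun h => hi ?_
      rw [← h]; simpa using ht
  simp only [h]
  rw [Finset.expect_sum_comm]
  simp only [expect_ind_apply_eq, Finset.sum_const, card_filter_val_lt hk, nsmul_eq_mul]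
  ring

theorem sum_ind_symm_lt {k : ℕ} (hk : k ≤ n) (σ : Equiv.Perm (Fin n)) :
    ∑ i, ind ((σ.symm i : ℕ) < k) = k := by
  rw [Equiv.sum_comp σ.symm (fun t : Fin n => ind ((t : ℕ) < k)), sum_ind, card_filter_val_lt hk]

/-- The events that two items arrive in the first `k` rounds are negatively correlated. -/
theorem expect_ind_pair_le {k : ℕ} (hk : k ≤ n) {i j : Fin n} (hij : i ≠ j) :
    𝔼 σ : Equiv.Perm (Fin n), ind ((σ.symm i : ℕ) < k) * ind ((σ.symm j : ℕ) < k)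
      ≤ ((k : ℝ) / n) ^ 2 := by
  set P : Fin n → ℝ := fun c =>
    𝔼 σ : Equiv.Perm (Fin n), ind ((σ.symm i : ℕ) < k) * ind ((σ.symm c : ℕ) < k) with hP
  have h : ∀ c, c ≠ i → P c = P j := by
    intro c hc
    rw [hP]
    simp only
    rw [← expect_mul_left (Equiv.swap j c)]
    refine Finset.expect_congr rfl fun σ _ => ?_
    have h1 : (Equiv.swap j c * σ).symm i = σ.symm i := by
      rw [Equiv.symm_apply_eq, Equiv.Perm.mul_apply, Equiv.apply_symm_apply,
        Equiv.swap_apply_of_ne_of_ne hij hc.symm]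
    have h2 : (Equiv.swap j c * σ).symm c = σ.symm j := by
      rw [Equiv.symm_apply_eq, Equiv.Perm.mul_apply, Equiv.apply_symm_apply,
        Equiv.swap_apply_left]
    rw [h1, h2]
  have hii : P i = k / n := by
    rw [← expect_ind_symm_lt hk i]
    refine Finset.expect_congr rfl fun σ _ => ?_
    by_cases h : (σ.symm i : ℕ) < k <;> simp [ind, h]
  have hs : ∑ c, P c = k * (k / n) := by
    rw [hP]
    simp only
    rw [← Finset.expect_sum_comm]
    simp only [← Finset.mul_sum, sum_ind_symm_lt hk]
    rw [← Finset.expect_mul, expect_ind_symm_lt hk, mul_comm]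
  rw [← Finset.add_sum_erase _ _ (Finset.mem_univ i), hii,
    Finset.sum_congr rfl (fun c hc => h c (Finset.ne_of_mem_erase hc)), Finset.sum_const,
    Finset.card_erase_of_mem (Finset.mem_univ i), Finset.card_univ, Fintype.card_fin,
    nsmul_eq_mul] at hs
  have hn2 : 2 ≤ n := by
    have := i.isLt; have := j.isLt; have : (i : ℕ) ≠ j := fun h => hij (Fin.ext h)
    omega
  rw [Nat.cast_sub (by omega)] at hs
  push_cast at hs
  have hn : (2 : ℝ) ≤ n := by exact_mod_cast hn2
  have hkn : (k : ℝ) ≤ n := by exact_mod_cast hk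
  have hk0 : (0 : ℝ) ≤ k := Nat.cast_nonneg k
  change P j ≤ _
  set x : ℝ := (k : ℝ) / n with hx
  have hxk : (k : ℝ) = x * n := by rw [hx]; field_simp
  have hx0 : 0 ≤ x := by positivity
  have hx1 : x ≤ 1 := by rw [hx]; exact div_le_one_of_le₀ hkn (by positivity)
  have : ((n : ℝ) - 1) * P j ≤ ((n : ℝ) - 1) * x ^ 2 := by
    rw [hxk] at hs
    nlinarith
  exact le_of_mul_le_mul_left this (by linarith)

/-- The number of items of `T` among the first `k` arrivals has variance at most its mean. -/
theorem expect_sq_sample_le {k : ℕ} (hk : k ≤ n) (T : Finset (Fin n)) :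
    𝔼 σ : Equiv.Perm (Fin n),
      (∑ i ∈ T, ind ((σ.symm i : ℕ) < k) - (k : ℝ) / n * T.card) ^ 2 ≤ (k : ℝ) / n * T.card := by
  set p : ℝ := (k : ℝ) / n with hp
  have hp0 : 0 ≤ p := by positivity
  set c : ℝ := (T.card : ℝ) with hc
  have hX : 𝔼 σ : Equiv.Perm (Fin n), ∑ i ∈ T, ind ((σ.symm i : ℕ) < k) = c * p := by
    rw [Finset.expect_sum_comm]
    simp only [expect_ind_symm_lt hk, Finset.sum_const, nsmul_eq_mul, ← hp, hc]
  have hX2 : 𝔼 σ : Equiv.Perm (Fin n), (∑ i ∈ T, ind ((σ.symm i : ℕ) < k)) ^ 2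
      ≤ c * (p + (c - 1) * p ^ 2) := by
    simp only [sq (∑ i ∈ T, _), Finset.sum_mul_sum]
    rw [Finset.expect_sum_comm, hc, ← nsmul_eq_mul]
    refine Finset.sum_le_card_nsmul _ _ _ fun i hi => ?_
    rw [Finset.expect_sum_comm, ← Finset.add_sum_erase _ _ hi]
    refine add_le_add ?_ ?_
    · rw [hp, ← expect_ind_symm_lt hk i]
      refine expect_mono fun σ => ?_
      exact mul_le_of_le_one_right (ind_nonneg _) (ind_le_one _)
    · calc _ ≤ (T.erase i).card • p ^ 2 :=
            Finset.sum_le_card_nsmul _ _ _ fun j hj =>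
              expect_ind_pair_le hk (Finset.ne_of_mem_erase hj).symm
        _ = _ := by
            rw [Finset.card_erase_of_mem hi, nsmul_eq_mul,
              Nat.cast_sub (Finset.card_pos.mpr ⟨i, hi⟩)]
            simp
  have hexp : ∀ σ : Equiv.Perm (Fin n),
      (∑ i ∈ T, ind ((σ.symm i : ℕ) < k) - p * c) ^ 2 =
      (∑ i ∈ T, ind ((σ.symm i : ℕ) < k)) ^ 2
        - 2 * (p * c) * (∑ i ∈ T, ind ((σ.symm i : ℕ) < k)) + (p * c) ^ 2 := fun σ => by ring
  simp only [hexp]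
  rw [Finset.expect_add_distrib, Finset.expect_sub_distrib, ← Finset.mul_expect, hX,
    Fintype.expect_const]
  have hc0 : 0 ≤ c := Nat.cast_nonneg _
  nlinarith [mul_nonneg hc0 (sq_nonneg p)]

/-! ### One-step transition laws for instances whose `L` best items are the large ones -/

/-- Two arrival orders that an ordinal algorithm cannot tell apart after `t` rounds, when the large
items are exactly the items `0, …, L - 1`. -/
def SamePast (L t : ℕ) (σ τ : Equiv.Perm (Fin n)) : Prop :=
  (∀ i : Fin n, (i : ℕ) < t → ((σ i : ℕ) < L ↔ (τ i : ℕ) < L)) ∧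
    ∀ i j : Fin n, (i : ℕ) < t → (j : ℕ) < t → (σ i < σ j ↔ τ i < τ j)

/-- Functions of the arrival order that are determined by the ordinal information of the first `t`
rounds. -/
def PastMeas (L t : ℕ) {α : Type*} (f : Equiv.Perm (Fin n) → α) : Prop :=
  ∀ σ τ, SamePast L t σ τ → f σ = f τ

/-- The number of large items among the first `t` arrivals. -/
def seen (L t : ℕ) (σ : Equiv.Perm (Fin n)) : ℕ :=
  (Finset.univ.filter fun i : Fin n => (i : ℕ) < t ∧ (σ i : ℕ) < L).card

theorem pastMeas_seen (L t : ℕ) : PastMeas L t (seen (n := n) L t) := by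
  intro σ τ h
  unfold seen
  congr 1
  ext i
  simp only [Finset.mem_filter, Finset.mem_univ, true_and]
  exact and_congr_right fun hi => h.1 i hi

theorem PastMeas.mul {L t : ℕ} {f g : Equiv.Perm (Fin n) → ℝ} (hf : PastMeas L t f)
    (hg : PastMeas L t g) : PastMeas L t fun σ => f σ * g σ := by
  intro σ τ h
  simp only [hf σ τ h, hg σ τ h]

theorem PastMeas.comp_seen {L t : ℕ} {α : Type*} (F : ℕ → α) :
    PastMeas (n := n) L t fun σ => F (seen L t σ) := by
  intro σ τ h
  simp only [pastMeas_seen L t σ τ h]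

theorem samePast_of_eq {L t : ℕ} {σ τ : Equiv.Perm (Fin n)}
    (h : ∀ i : Fin n, (i : ℕ) < t → σ i = τ i) : SamePast L t σ τ :=
  ⟨fun i hi => by rw [h i hi], fun i j hi hj => by rw [h i hi, h j hj]⟩

theorem seen_le {L t : ℕ} (σ : Equiv.Perm (Fin n)) : seen L t σ ≤ t := by
  unfold seen
  calc _ ≤ (Finset.univ.filter fun i : Fin n => (i : ℕ) < t).card :=
        Finset.card_le_card fun i => by simp only [Finset.mem_filter]; tauto
    _ ≤ t := by rw [Fin.card_filter_val_lt]; exact min_le_right _ _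

theorem card_filter_apply_lt {L : ℕ} (hL : L ≤ n) (σ : Equiv.Perm (Fin n)) :
    (Finset.univ.filter fun i : Fin n => (σ i : ℕ) < L).card = L := by
  rw [← card_filter_val_lt hL]
  exact Finset.card_equiv σ (by simp [card_filter_val_lt hL])

theorem seen_add_card {L t : ℕ} (hL : L ≤ n) (σ : Equiv.Perm (Fin n)) :
    seen L t σ + (Finset.univ.filter fun i : Fin n => t ≤ (i : ℕ) ∧ (σ i : ℕ) < L).card = L := by
  unfold seen
  rw [← Finset.card_union_of_disjoint]
  · rw [← Finset.filter_or]
    conv_rhs => rw [← card_filter_apply_lt hL σ]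
    congr 1
    ext i
    simp only [Finset.mem_filter, Finset.mem_univ, true_and]
    have := lt_or_ge (i : ℕ) t
    tauto
  · rw [Finset.disjoint_filter]
    intro i _ h1 h2
    omega

theorem seen_le_large {L t : ℕ} (hL : L ≤ n) (σ : Equiv.Perm (Fin n)) : seen L t σ ≤ L := by
  have := seen_add_card (t := t) hL σ
  omega

theorem seen_succ {L : ℕ} (t : Fin n) (σ : Equiv.Perm (Fin n)) [Decidable ((σ t : ℕ) < L)] :
    seen L (t + 1) σ = seen L t σ + if (σ t : ℕ) < L then 1 else 0 := by
  unfold seen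
  have h : (Finset.univ.filter fun i : Fin n => (i : ℕ) < t + 1 ∧ (σ i : ℕ) < L) =
      (Finset.univ.filter fun i : Fin n => (i : ℕ) < t ∧ (σ i : ℕ) < L) ∪
        (if (σ t : ℕ) < L then {t} else ∅) := by
    ext i
    have hi : (i : ℕ) < t + 1 ↔ (i : ℕ) < t ∨ i = t := by rw [Fin.ext_iff]; omega
    split_ifs with h <;> simp only [Finset.mem_filter, Finset.mem_univ, true_and, hi,
      Finset.mem_union, Finset.mem_singleton, Finset.notMem_empty, or_false]
    · constructor
      · rintro ⟨h1 | h1, h2⟩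
        · exact Or.inl ⟨h1, h2⟩
        · exact Or.inr h1
      · rintro (h1 | rfl)
        · exact ⟨Or.inl h1.1, h1.2⟩
        · exact ⟨Or.inr rfl, h⟩
    · constructor
      · rintro ⟨h1 | rfl, h2⟩
        · exact ⟨h1, h2⟩
        · exact absurd h2 h
      · rintro h1
        exact ⟨Or.inl h1.1, h1.2⟩
  rw [h, Finset.card_union_of_disjoint]
  · split_ifs <;> simp
  · split_ifs <;> simp

/-- Given the ordinal past, the next arrival is large with probability equal to the proportion of
large items among those still to come: exchanging the rounds `t` and `u ≥ t` preserves the past. -/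
theorem expect_mul_ind_large {L : ℕ} (hL : L ≤ n) (t : Fin n) {f : Equiv.Perm (Fin n) → ℝ}
    (hf : PastMeas L t f) :
    𝔼 σ, f σ * ind ((σ t : ℕ) < L) = 𝔼 σ, f σ * (((L : ℝ) - seen L t σ) / ((n : ℝ) - t)) := by
  have hswap : ∀ u : Fin n, t ≤ u →
      𝔼 σ, f σ * ind ((σ u : ℕ) < L) = 𝔼 σ, f σ * ind ((σ t : ℕ) < L) := by
    intro u hu
    rw [← expect_mul_right (Equiv.swap t u)]
    refine Finset.expect_congr rfl fun σ _ => ?_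
    rw [hf (σ * Equiv.swap t u) σ (samePast_of_eq fun i hi => ?_)]
    · simp
    · have h1 : i ≠ t := fun h => by rw [h] at hi; omega
      have h2 : i ≠ u := fun h => by rw [h] at hi; have : (t : ℕ) ≤ u := hu; omega
      rw [Equiv.Perm.mul_apply, Equiv.swap_apply_of_ne_of_ne h1 h2]
  have hnt : (0 : ℝ) < (n : ℝ) - t := by
    have : (t : ℝ) < n := by exact_mod_cast t.isLt
    linarith
  have hsum : ((n : ℝ) - t) * 𝔼 σ, f σ * ind ((σ t : ℕ) < L) =
      𝔼 σ, f σ * ((L : ℝ) - seen L t σ) := by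
    have h1 : ∑ u ∈ Finset.Ici t, 𝔼 σ, f σ * ind ((σ u : ℕ) < L) =
        ((n : ℝ) - t) * 𝔼 σ, f σ * ind ((σ t : ℕ) < L) := by
      rw [Finset.sum_congr rfl fun u hu => hswap u (Finset.mem_Ici.mp hu), Finset.sum_const,
        Fin.card_Ici, nsmul_eq_mul, Nat.cast_sub t.isLt.le]
    rw [← h1, ← Finset.expect_sum_comm]
    refine Finset.expect_congr rfl fun σ _ => ?_
    rw [← Finset.mul_sum, sum_ind]
    congr 1
    have h2 := seen_add_card (t := t) hL σ
    have h3 : (Finset.Ici t).filter (fun i => (σ i : ℕ) < L) =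
        Finset.univ.filter fun i : Fin n => (t : ℕ) ≤ (i : ℕ) ∧ (σ i : ℕ) < L := by
      ext i
      simp only [Finset.mem_filter, Finset.mem_Ici, Finset.mem_univ, true_and, Fin.le_def]
    rw [h3]
    have h4 : (L : ℝ) = seen L t σ +
        (Finset.univ.filter fun i : Fin n => (t : ℕ) ≤ (i : ℕ) ∧ (σ i : ℕ) < L).card := by
      exact_mod_cast h2.symm
    linarith
  rw [← mul_right_inj' hnt.ne', hsum, Finset.mul_expect]
  refine Finset.expect_congr rfl fun σ _ => ?_
  field_simp

/-! ### Relative ranks -/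

/-- The set of the first `t + 1` arrivals. -/
def arrived (t : Fin n) (σ : Equiv.Perm (Fin n)) : Finset (Fin n) :=
  (Finset.Iic t).map σ.toEmbedding

theorem card_arrived (t : Fin n) (σ : Equiv.Perm (Fin n)) : (arrived t σ).card = t + 1 := by
  simp [arrived]

/-- The item of relative rank `r` among the first `t + 1` arrivals. -/
def ranked (t : Fin n) (σ : Equiv.Perm (Fin n)) : Fin (t + 1) ↪o Fin n :=
  (arrived t σ).orderEmbOfFin (card_arrived t σ)

theorem mem_arrived {t : Fin n} {σ : Equiv.Perm (Fin n)} {i : Fin n} (hi : i ≤ t) :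
    σ i ∈ arrived t σ := by
  simpa [arrived] using hi

theorem exists_ranked_eq {t : Fin n} {σ : Equiv.Perm (Fin n)} {x : Fin n}
    (hx : x ∈ arrived t σ) : ∃ r, ranked t σ r = x := by
  have : x ∈ Set.range (ranked t σ) := by
    rw [ranked, Finset.range_orderEmbOfFin]; exact hx
  exact this

theorem ranked_mem (t : Fin n) (σ : Equiv.Perm (Fin n)) (r : Fin (t + 1)) :
    ranked t σ r ∈ arrived t σ :=
  Finset.orderEmbOfFin_mem _ _ _

theorem card_filter_arrived (L : ℕ) (t : Fin n) (σ : Equiv.Perm (Fin n)) :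
    ((arrived t σ).filter fun x : Fin n => (x : ℕ) < L).card = seen L (t + 1) σ := by
  rw [arrived, Finset.filter_map, Finset.card_map, seen]
  congr 1
  ext i
  simp only [Finset.mem_filter, Finset.mem_Iic, Finset.mem_univ, true_and, Fin.le_def,
    Nat.lt_succ_iff, Function.comp_apply, Equiv.toEmbedding_apply]

theorem ranked_lt_iff (L : ℕ) (t : Fin n) (σ : Equiv.Perm (Fin n)) (r : Fin (t + 1)) :
    (ranked t σ r : ℕ) < L ↔ (r : ℕ) < seen L (t + 1) σ := by
  have h : (arrived t σ).filter (fun x : Fin n => (x : ℕ) < L) =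
      (Finset.univ.filter fun s : Fin (t + 1) => (ranked t σ s : ℕ) < L).map
        (ranked t σ).toEmbedding := by
    ext x
    simp only [Finset.mem_filter, Finset.mem_map, Finset.mem_univ, true_and]
    constructor
    · rintro ⟨hx, hxL⟩
      obtain ⟨s, rfl⟩ := exists_ranked_eq hx
      exact ⟨s, hxL, rfl⟩
    · rintro ⟨s, hs, rfl⟩
      exact ⟨ranked_mem t σ s, hs⟩
  rw [← card_filter_arrived, h, Finset.card_map]
  constructor
  · intro hr
    have : Finset.Iic r ⊆ Finset.univ.filter fun s : Fin (t + 1) => (ranked t σ s : ℕ) < L := by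
      intro s hs
      simp only [Finset.mem_filter, Finset.mem_univ, true_and]
      exact lt_of_le_of_lt ((ranked t σ).monotone (Finset.mem_Iic.mp hs)) hr
    have := Finset.card_le_card this
    rw [Fin.card_Iic] at this
    omega
  · intro hr
    by_contra hL
    have : (Finset.univ.filter fun s : Fin (t + 1) => (ranked t σ s : ℕ) < L) ⊆ Finset.Iio r := by
      intro s hs
      simp only [Finset.mem_filter, Finset.mem_univ, true_and] at hs
      rw [Finset.mem_Iio]
      by_contra hsr
      exact hL (lt_of_le_of_lt ((ranked t σ).monotone (not_lt.mp hsr)) hs)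
    have := Finset.card_le_card this
    rw [Fin.card_Iio] at this
    omega

/-- Exchanging the newest item with an item adjacent to it in the order of the arrived items does
not change the ordinal past. -/
theorem samePast_swap {L : ℕ} {t x y : Fin n} {σ : Equiv.Perm (Fin n)} (hxy : x < y)
    (hyL : (y : ℕ) < L) (ht : σ t = x ∨ σ t = y)
    (hbetween : ∀ i : Fin n, i ≤ t → ¬ (x < σ i ∧ σ i < y)) :
    SamePast L t σ (Equiv.swap x y * σ) := by
  have hxL : (x : ℕ) < L := lt_trans hxy hyL
  refine ⟨fun i _ => ?_, fun i j hi hj => ?_⟩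
  · rw [Equiv.Perm.mul_apply, Equiv.swap_apply_def]
    split_ifs with h1 h2
    · rw [h1]; tauto
    · rw [h2]; tauto
    · rfl
  · have hit : i ≠ t := fun h => by rw [h] at hi; omega
    have hjt : j ≠ t := fun h => by rw [h] at hj; omega
    have hi' := hbetween i (by rw [Fin.le_def]; omega)
    have hj' := hbetween j (by rw [Fin.le_def]; omega)
    have hit' : σ i ≠ σ t := fun h => hit (σ.injective h)
    have hjt' : σ j ≠ σ t := fun h => hjt (σ.injective h)
    rw [Equiv.Perm.mul_apply, Equiv.Perm.mul_apply, Equiv.swap_apply_def, Equiv.swap_apply_def]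
    split_ifs <;> omega

/-- Exchange the items of relative ranks `r` and `s` among the first `t + 1` arrivals. -/
def rankSwap (t : Fin n) (r s : Fin (t + 1)) (σ : Equiv.Perm (Fin n)) : Equiv.Perm (Fin n) :=
  Equiv.swap (ranked t σ r) (ranked t σ s) * σ

theorem arrived_rankSwap (t : Fin n) (r s : Fin (t + 1)) (σ : Equiv.Perm (Fin n)) :
    arrived t (rankSwap t r s σ) = arrived t σ := by
  have h : arrived t (rankSwap t r s σ) =
      (arrived t σ).map (Equiv.swap (ranked t σ r) (ranked t σ s)).toEmbedding := by
    rw [arrived, arrived, Finset.map_map]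
    rfl
  rw [h]
  refine Finset.eq_of_subset_of_card_le (fun x hx => ?_) (by rw [Finset.card_map])
  rw [Finset.mem_map] at hx
  obtain ⟨z, hz, rfl⟩ := hx
  rw [Equiv.toEmbedding_apply, Equiv.swap_apply_def]
  split_ifs
  · exact ranked_mem t σ s
  · exact ranked_mem t σ r
  · exact hz

theorem ranked_rankSwap (t : Fin n) (r s : Fin (t + 1)) (σ : Equiv.Perm (Fin n)) :
    ranked t (rankSwap t r s σ) = ranked t σ := by
  unfold ranked
  congr 1
  exact arrived_rankSwap t r s σ

theorem rankSwap_involutive (t : Fin n) (r s : Fin (t + 1)) :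
    Function.Involutive (rankSwap t r s) := by
  intro σ
  conv_lhs => rw [rankSwap, ranked_rankSwap, rankSwap]
  rw [← mul_assoc, Equiv.swap_mul_self, one_mul]

/-- Given the ordinal past, consecutive relative ranks of the newest item are equally likely, as
long as both of them belong to large items. -/
theorem expect_rank_succ {L : ℕ} (t : Fin n) {f : Equiv.Perm (Fin n) → ℝ}
    (hf : PastMeas L t f) (r : ℕ) (hr : r + 1 < t + 1) :
    𝔼 σ, f σ * (ind (σ t = ranked t σ ⟨r + 1, hr⟩) * ind ((ranked t σ ⟨r + 1, hr⟩ : ℕ) < L)) =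
      𝔼 σ, f σ * (ind (σ t = ranked t σ ⟨r, by omega⟩) *
        ind ((ranked t σ ⟨r + 1, hr⟩ : ℕ) < L)) := by
  set a : Fin (t + 1) := ⟨r, by omega⟩ with ha
  set b : Fin (t + 1) := ⟨r + 1, hr⟩ with hb
  refine Fintype.expect_equiv (rankSwap_involutive t a b).toPerm _ _ fun σ => ?_
  simp only [Function.Involutive.coe_toPerm, ranked_rankSwap]
  have hiff : rankSwap t a b σ t = ranked t σ a ↔ σ t = ranked t σ b := by
    rw [rankSwap, Equiv.Perm.mul_apply, ← Equiv.eq_symm_apply, Equiv.symm_swap,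
      Equiv.swap_apply_left]
  rw [hiff]
  by_cases h : σ t = ranked t σ b ∧ (ranked t σ b : ℕ) < L
  · rw [hf σ (rankSwap t a b σ)]
    refine samePast_swap ((ranked t σ).strictMono (by simp [ha, hb])) h.2 (Or.inr h.1) ?_
    rintro i hi ⟨h1, h2⟩
    obtain ⟨c, hc⟩ := exists_ranked_eq (mem_arrived (σ := σ) hi)
    rw [← hc, OrderEmbedding.lt_iff_lt] at h1 h2
    rw [Fin.lt_def] at h1 h2
    simp only [ha, hb] at h1 h2
    omega
  · rw [← ind_and, ind_false h]
    ring

/-- The newest item is large and the best item so far. -/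
def IsRecord (L : ℕ) (t : Fin n) (σ : Equiv.Perm (Fin n)) : Prop :=
  (σ t : ℕ) < L ∧ ∀ i : Fin n, i < t → σ t < σ i

theorem isRecord_iff (L : ℕ) (t : Fin n) (σ : Equiv.Perm (Fin n)) :
    IsRecord L t σ ↔ σ t = ranked t σ 0 ∧ (σ t : ℕ) < L := by
  constructor
  · rintro ⟨h1, h2⟩
    refine ⟨?_, h1⟩
    obtain ⟨r, hr⟩ := exists_ranked_eq (mem_arrived (σ := σ) (le_refl t))
    have h0 : ranked t σ 0 ≤ σ t := by
      rw [← hr]; exact (ranked t σ).monotone (Fin.zero_le r)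
    have hm := ranked_mem t σ 0
    rw [arrived, Finset.mem_map] at hm
    obtain ⟨i, hi, hi'⟩ := hm
    rw [Finset.mem_Iic] at hi
    rw [Equiv.toEmbedding_apply] at hi'
    rcases hi.lt_or_eq with h | h
    · have := h2 i h
      rw [hi'] at this
      exact absurd h0 (not_le.mpr this)
    · subst h; exact hi'
  · rintro ⟨h1, h2⟩
    refine ⟨h2, fun i hi => lt_of_le_of_ne ?_ fun h => ?_⟩
    · obtain ⟨r, hr⟩ := exists_ranked_eq (mem_arrived (σ := σ) hi.le)
      rw [h1, ← hr]
      exact (ranked t σ).monotone (Fin.zero_le r)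
    · exact hi.ne (σ.injective h.symm)

/-- Given the ordinal past, every relative rank that a large newest item can have is as likely as
being a record. -/
theorem expect_rank_eq {L : ℕ} (t : Fin n) (r : ℕ) (hr : r < t + 1) :
    ∀ {f : Equiv.Perm (Fin n) → ℝ}, PastMeas L t f →
    𝔼 σ, f σ * ind (r ≤ seen L t σ) * (ind (σ t = ranked t σ ⟨r, hr⟩) * ind ((σ t : ℕ) < L)) =
      𝔼 σ, f σ * ind (r ≤ seen L t σ) * ind (IsRecord L t σ) := by
  induction r with
  | zero =>
    intro f _
    refine Finset.expect_congr rfl fun σ _ => ?_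
    rw [isRecord_iff, ind_and]
    rfl
  | succ r ih =>
    intro f hf
    have hg : PastMeas L t fun σ => f σ * ind (r + 1 ≤ seen L t σ) :=
      hf.mul (PastMeas.comp_seen fun l => ind (r + 1 ≤ l))
    have h1 := expect_rank_succ t hg r hr
    have h2 := ih (by omega) hg
    have e1 : ∀ σ, f σ * ind (r + 1 ≤ seen L t σ) *
        (ind (σ t = ranked t σ ⟨r + 1, hr⟩) * ind ((σ t : ℕ) < L)) =
        f σ * ind (r + 1 ≤ seen L t σ) * (ind (σ t = ranked t σ ⟨r + 1, hr⟩) *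
          ind ((ranked t σ ⟨r + 1, hr⟩ : ℕ) < L)) := by
      intro σ
      by_cases h : σ t = ranked t σ ⟨r + 1, hr⟩
      · rw [← h]
      · rw [ind_false h]; ring
    have e2 : ∀ σ, f σ * ind (r + 1 ≤ seen L t σ) * (ind (σ t = ranked t σ ⟨r, by omega⟩) *
          ind ((ranked t σ ⟨r + 1, hr⟩ : ℕ) < L)) =
        f σ * ind (r + 1 ≤ seen L t σ) * ind (r ≤ seen L t σ) *
          (ind (σ t = ranked t σ ⟨r, by omega⟩) * ind ((σ t : ℕ) < L)) := by
      intro σ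
      by_cases h : σ t = ranked t σ ⟨r, by omega⟩
      · by_cases hs : r + 1 ≤ seen L t σ
        · rw [ind_true hs, ind_true (show r ≤ seen L t σ by omega)]
          have hle : seen L t σ ≤ seen L (t + 1) σ := by rw [seen_succ]; omega
          have hrL : (ranked t σ ⟨r, by omega⟩ : ℕ) < L := by
            rw [ranked_lt_iff]; simp only; omega
          have hrL' : (ranked t σ ⟨r + 1, hr⟩ : ℕ) < L := by
            rw [ranked_lt_iff, seen_succ, if_pos (by rw [h]; exact hrL)]
            simp only; omega
          rw [ind_true hrL', h, ind_true hrL]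
          ring
        · rw [ind_false hs]; ring
      · rw [ind_false h]; ring
    have e3 : ∀ σ, f σ * ind (r + 1 ≤ seen L t σ) * ind (r ≤ seen L t σ) *
        ind (IsRecord L t σ) = f σ * ind (r + 1 ≤ seen L t σ) * ind (IsRecord L t σ) := by
      intro σ
      by_cases hs : r + 1 ≤ seen L t σ
      · rw [ind_true (show r ≤ seen L t σ by omega)]; ring
      · rw [ind_false hs]; ring
    simp only [e1, h1, e2]
    rw [h2]
    simp only [e3]

/-- Given the ordinal past and that the next arrival is large, it beats all `ℓ` large items seen
before with probability `1 / (ℓ + 1)`. -/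
theorem expect_mul_ind_record {L : ℕ} (t : Fin n) {f : Equiv.Perm (Fin n) → ℝ}
    (hf : PastMeas L t f) :
    𝔼 σ, f σ * ind (IsRecord L t σ) =
      𝔼 σ, f σ * (ind ((σ t : ℕ) < L) / (seen L t σ + 1)) := by
  have hg : PastMeas L t fun σ => f σ * (1 / ((seen L t σ : ℝ) + 1)) :=
    hf.mul (PastMeas.comp_seen fun l => 1 / ((l : ℝ) + 1))
  have h := Finset.sum_congr (rfl : (Finset.univ : Finset (Fin (t + 1))) = Finset.univ)
    fun r _ => expect_rank_eq t r r.isLt hg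
  rw [← Finset.expect_sum_comm, ← Finset.expect_sum_comm] at h
  have e1 : ∀ σ, ∑ r : Fin (t + 1),
      f σ * (1 / ((seen L t σ : ℝ) + 1)) * ind ((r : ℕ) ≤ seen L t σ) *
      (ind (σ t = ranked t σ ⟨r, r.isLt⟩) * ind ((σ t : ℕ) < L)) =
      f σ * (ind ((σ t : ℕ) < L) / (seen L t σ + 1)) := by
    intro σ
    obtain ⟨r, hr⟩ := exists_ranked_eq (mem_arrived (σ := σ) (le_refl t))
    rw [Finset.sum_eq_single r]
    · rw [ind_true hr.symm]
      by_cases hL : (σ t : ℕ) < L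
      · have hrs : (r : ℕ) ≤ seen L t σ := by
          have := (ranked_lt_iff L t σ r).mp (by rw [hr]; exact hL)
          rw [seen_succ, if_pos hL] at this
          omega
        rw [ind_true hrs]
        ring
      · rw [ind_false hL]; ring
    · intro s _ hs
      rw [ind_false (p := σ t = _)]
      · ring
      · rw [← hr]
        exact fun h => hs ((ranked t σ).injective h).symm
    · simp
  have e2 : ∀ σ, ∑ r : Fin (t + 1),
      f σ * (1 / ((seen L t σ : ℝ) + 1)) * ind ((r : ℕ) ≤ seen L t σ) *
      ind (IsRecord L t σ) = f σ * ind (IsRecord L t σ) := by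
    intro σ
    have hc : ∑ r : Fin (t + 1), ind ((r : ℕ) ≤ seen L t σ) = seen L t σ + 1 := by
      rw [sum_ind]
      have h1 := seen_le (L := L) (t := t) σ
      have : (Finset.univ.filter fun r : Fin (t + 1) => (r : ℕ) ≤ seen L t σ).card =
          seen L t σ + 1 := by
        simp only [← Nat.lt_succ_iff]
        exact card_filter_val_lt (by omega)
      rw [this]
      push_cast
      rfl
    rw [← Finset.sum_mul, ← Finset.mul_sum, hc]
    have : (seen L t σ : ℝ) + 1 ≠ 0 := by positivity
    field_simp
  simp only [e1, e2] at h
  exact h.symm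

/-! ### The potential bounding what an algorithm can still gain -/

/-- The value function of the continuous-time secretary problem, scaled by `e`: the best possible
`e · P(win)` when a fraction `x` of the candidates has passed. -/
noncomputable def secretaryValue (x : ℝ) : ℝ :=
  if Real.exp 1 * x ≤ 1 then 1 else Real.exp 1 * Real.negMulLog x

theorem exp_one_mul_negMulLog_le_one {x : ℝ} (hx : 0 ≤ x) :
    Real.exp 1 * Real.negMulLog x ≤ 1 := by
  rcases hx.eq_or_lt with rfl | hx
  · simp
  have he := Real.exp_pos 1
  have h := Real.log_le_sub_one_of_pos (x := 1 / (Real.exp 1 * x)) (by positivity)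
  rw [one_div, Real.log_inv, Real.log_mul he.ne' hx.ne', Real.log_exp] at h
  have h2 : -Real.log x ≤ (Real.exp 1 * x)⁻¹ := by linarith
  calc Real.exp 1 * Real.negMulLog x = (Real.exp 1 * x) * (-Real.log x) := by
        rw [Real.negMulLog]; ring
    _ ≤ (Real.exp 1 * x) * (Real.exp 1 * x)⁻¹ :=
        mul_le_mul_of_nonneg_left h2 (by positivity)
    _ = 1 := mul_inv_cancel₀ (by positivity)

theorem negMulLog_le_secretaryValue {x : ℝ} (hx : 0 ≤ x) :
    Real.exp 1 * Real.negMulLog x ≤ secretaryValue x := by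
  unfold secretaryValue
  split_ifs
  · exact exp_one_mul_negMulLog_le_one hx
  · exact le_rfl

/-- The value function is non-increasing: on `[1 / e, 1]` the bound `e · negMulLog y ≤ 1` serves
again, in the form `-log y ≤ x / y`. -/
theorem secretaryValue_anti {x y : ℝ} (hx : 0 ≤ x) (hxy : x ≤ y) :
    secretaryValue y ≤ secretaryValue x := by
  have he := Real.exp_pos 1
  by_cases h : Real.exp 1 * x ≤ 1
  · rw [secretaryValue, secretaryValue, if_pos h]
    split_ifs
    · exact le_rfl
    · exact exp_one_mul_negMulLog_le_one (hx.trans hxy)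
  · have hy : ¬ Real.exp 1 * y ≤ 1 := fun h' =>
      h ((mul_le_mul_of_nonneg_left hxy he.le).trans h')
    rw [secretaryValue, secretaryValue, if_neg h, if_neg hy]
    refine mul_le_mul_of_nonneg_left ?_ he.le
    have hx0 : 0 < x := by
      rcases hx.eq_or_lt with rfl | hx
      · simp at h
      · exact hx
    have hy0 : 0 < y := hx0.trans_le hxy
    have h1 := Real.one_sub_inv_le_log_of_pos (x := y / x) (by positivity)
    rw [Real.log_div hy0.ne' hx0.ne', inv_div] at h1
    have h2 := exp_one_mul_negMulLog_le_one hy0.le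
    rw [Real.negMulLog] at h2
    have h3 : -Real.log y * y ≤ x := by
      have : Real.exp 1 * (-y * Real.log y) ≤ Real.exp 1 * x := h2.trans (not_le.mp h).le
      have := le_of_mul_le_mul_left this he
      linarith
    have h4 : -Real.log y ≤ x / y := by rw [le_div_iff₀ hy0]; exact h3
    rw [Real.negMulLog, Real.negMulLog]
    have h5 : 0 ≤ (y - x) * (x / y + Real.log y) :=
      mul_nonneg (by linarith) (by linarith)
    have h6 : x * (1 - x / y) = (y - x) * (x / y) := by field_simp
    nlinarith [mul_le_mul_of_nonneg_left h1 hx0.le]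

theorem one_sub_le_secretaryValue {x : ℝ} (hx : 0 ≤ x) (hx1 : x ≤ 1) :
    1 - x ≤ secretaryValue x := by
  unfold secretaryValue
  split_ifs with h
  · linarith
  · have hx0 : 0 < x := by
      rcases hx.eq_or_lt with rfl | hx
      · simp at h
      · exact hx
    have h1 := Real.log_le_sub_one_of_pos hx0
    rw [Real.negMulLog]
    nlinarith

/-- The secretary part of the potential after `l` of `L` large items: the continuous value plus
a discretization error. -/
noncomputable def wPot (L l : ℕ) : ℝ := secretaryValue (l / L) + Real.exp 1 / L

theorem wPot_succ_le {L l : ℕ} : wPot L (l + 1) ≤ wPot L l := by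
  unfold wPot
  refine add_le_add ?_ le_rfl
  refine secretaryValue_anti (by positivity) ?_
  push_cast
  gcongr
  linarith

theorem one_sub_le_wPot {L l : ℕ} (hL : 0 < L) (hl : l ≤ L) : ((L : ℝ) - l) / L ≤ wPot L l := by
  have hL' : (0 : ℝ) < L := by exact_mod_cast hL
  have hl' : (l : ℝ) ≤ L := by exact_mod_cast hl
  have h := one_sub_le_secretaryValue (x := l / L) (by positivity)
    (div_le_one_of_le₀ hl' hL'.le)
  have : ((L : ℝ) - l) / L = 1 - l / L := by field_simp
  rw [this, wPot]
  have : 0 ≤ Real.exp 1 / L := by positivity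
  linarith

/-- `wPot` is a supersolution of the dynamic program of the secretary problem. -/
theorem wPot_step {L l : ℕ} (hl : l < L) :
    1 / ((l : ℝ) + 1) * max (Real.exp 1 * (l + 1) / L) (wPot L (l + 1)) +
      l / ((l : ℝ) + 1) * wPot L (l + 1) ≤ wPot L l := by
  have hL' : (0 : ℝ) < L := by exact_mod_cast (by omega : 0 < L)
  have he := Real.exp_pos 1
  have hl1 : (0 : ℝ) < (l : ℝ) + 1 := by positivity
  rcases le_total (Real.exp 1 * (l + 1) / L) (wPot L (l + 1)) with h | h
  · rw [max_eq_right h]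
    have : 1 / ((l : ℝ) + 1) * wPot L (l + 1) + l / ((l : ℝ) + 1) * wPot L (l + 1) =
        wPot L (l + 1) := by field_simp; ring
    rw [this]
    exact wPot_succ_le
  · rw [max_eq_left h]
    by_cases hcap : Real.exp 1 * (((l + 1 : ℕ) : ℝ) / L) ≤ 1
    · exfalso
      have h1 : wPot L (l + 1) = 1 + Real.exp 1 / L := by
        rw [wPot, secretaryValue, if_pos hcap]
      rw [h1] at h
      push_cast at hcap
      have : Real.exp 1 * (l + 1) / L = Real.exp 1 * (((l : ℝ) + 1) / L) := by ring
      have : 0 < Real.exp 1 / L := by positivity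
      linarith
    · have hw : wPot L (l + 1) = Real.exp 1 * Real.negMulLog (((l + 1 : ℕ) : ℝ) / L) +
          Real.exp 1 / L := by rw [wPot, secretaryValue, if_neg hcap]
      rcases Nat.eq_zero_or_pos l with rfl | hlpos
      · simp only [Nat.cast_zero, zero_add, zero_div, zero_mul, add_zero, mul_one, one_div,
          inv_one, one_mul]
        rw [wPot, secretaryValue, if_pos (by simp)]
        linarith
      · have hl0 : (0 : ℝ) < l := by exact_mod_cast hlpos
        have hcapl := negMulLog_le_secretaryValue (x := l / L) (by positivity)
        have h1 := Real.one_sub_inv_le_log_of_pos (x := ((l : ℝ) + 1) / l) (by positivity)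
        rw [Real.log_div hl1.ne' hl0.ne', inv_div] at h1
        rw [hw]
        unfold wPot
        rw [Real.negMulLog] at hcapl ⊢
        push_cast
        rw [Real.log_div hl0.ne' hL'.ne'] at hcapl
        rw [Real.log_div hl1.ne' hL'.ne']
        refine le_trans ?_ (add_le_add hcapl le_rfl)
        have e1 : 1 / ((l : ℝ) + 1) * (Real.exp 1 * (l + 1) / L) +
            l / ((l : ℝ) + 1) * (Real.exp 1 * (-(((l : ℝ) + 1) / L) *
              (Real.log (l + 1) - Real.log L)) + Real.exp 1 / L) =
            Real.exp 1 / L * (1 - l * (Real.log (l + 1) - Real.log L) + l / (l + 1)) := by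
          field_simp
          ring
        have e2 : Real.exp 1 * (-((l : ℝ) / L) * (Real.log l - Real.log L)) + Real.exp 1 / L =
            Real.exp 1 / L * (1 - l * (Real.log l - Real.log L)) := by
          field_simp
          ring
        rw [e1, e2]
        refine mul_le_mul_of_nonneg_left ?_ (by positivity)
        have h2 := mul_le_mul_of_nonneg_left h1 hl0.le
        have h3 : (l : ℝ) * (1 - l / (l + 1)) = l / (l + 1) := by field_simp; ring
        linarith

/-- Squared imbalance between the remaining fractions of small and of large items, plus the variance
still to come. It is a supermartingale along a uniformly random arrival order. -/
noncomputable def quadPot (L B : ℕ) (l s : ℕ) : ℝ :=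
  (((B : ℝ) - s) / B - ((L : ℝ) - l) / L) ^ 2 + ((L : ℝ) - l) / L ^ 2 + ((B : ℝ) - s) / B ^ 2

theorem quadPot_nonneg {L B l s : ℕ} (hl : l ≤ L) (hs : s ≤ B) : 0 ≤ quadPot L B l s := by
  have h1 : (0 : ℝ) ≤ (L : ℝ) - l := by rw [sub_nonneg]; exact_mod_cast hl
  have h2 : (0 : ℝ) ≤ (B : ℝ) - s := by rw [sub_nonneg]; exact_mod_cast hs
  unfold quadPot
  positivity

theorem quadPot_step {L B l s : ℕ} (hL : 0 < L) (hB : 0 < B)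
    (hN : (0 : ℝ) < (L : ℝ) + B - (l + s)) :
    ((L : ℝ) - l) / ((L : ℝ) + B - (l + s)) * quadPot L B (l + 1) s +
      ((B : ℝ) - s) / ((L : ℝ) + B - (l + s)) * quadPot L B l (s + 1) ≤ quadPot L B l s := by
  have hL' : (0 : ℝ) < L := by exact_mod_cast hL
  have hB' : (0 : ℝ) < B := by exact_mod_cast hB
  have key : ((L : ℝ) - l) * quadPot L B (l + 1) s + ((B : ℝ) - s) * quadPot L B l (s + 1) =
      ((L : ℝ) + B - (l + s)) * quadPot L B l s -
        2 * (((B : ℝ) - s) / B - ((L : ℝ) - l) / L) ^ 2 := by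
    unfold quadPot
    push_cast
    field_simp
    ring
  rw [div_mul_eq_mul_div, div_mul_eq_mul_div, ← add_div, div_le_iff₀ hN, key]
  nlinarith [sq_nonneg (((B : ℝ) - s) / B - ((L : ℝ) - l) / L)]

/-- The potential: an upper bound, up to `o(1)`, on the expected final value of
`e · 1[best item accepted] + (number of small items accepted) / B`, for an algorithm that has
accepted nothing so far and has seen `l` large and `s` small items. -/
noncomputable def pot (L B : ℕ) (ε : ℝ) (l s : ℕ) : ℝ :=
  wPot L l + 1 / B + (ε + quadPot L B l s / ε) / 2

theorem pot_nonneg {L B l s : ℕ} {ε : ℝ} (hL : 0 < L) (hε : 0 < ε) (hl : l ≤ L) (hs : s ≤ B) :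
    0 ≤ pot L B ε l s := by
  have h1 := quadPot_nonneg hl hs
  have h2 := one_sub_le_wPot hL hl
  have h3 : (0 : ℝ) ≤ (L : ℝ) - l := by rw [sub_nonneg]; exact_mod_cast hl
  have h4 : 0 ≤ ((L : ℝ) - l) / L := by positivity
  have h5 : 0 ≤ (ε + quadPot L B l s / ε) / 2 := by positivity
  have h6 : (0 : ℝ) ≤ 1 / B := by positivity
  unfold pot
  linarith

/-- Going for the small items does not beat the potential: the arithmetic-geometric mean
inequality bounds the imbalance by the quadratic part of the potential. -/
theorem small_le_pot {L B l s : ℕ} {ε : ℝ} (hL : 0 < L) (hB : 0 < B) (hε : 0 < ε) (hl : l ≤ L)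
    (hs : s < B) : ((B : ℝ) - s) / B ≤ pot L B ε l (s + 1) := by
  have hL' : (0 : ℝ) < L := by exact_mod_cast hL
  have hB' : (0 : ℝ) < B := by exact_mod_cast hB
  have h2 := one_sub_le_wPot hL hl
  set d : ℝ := ((B : ℝ) - (s + 1 : ℕ)) / B - ((L : ℝ) - l) / L with hd
  have hq : d ^ 2 ≤ quadPot L B l (s + 1) := by
    unfold quadPot
    have h1 : (0 : ℝ) ≤ (L : ℝ) - l := by rw [sub_nonneg]; exact_mod_cast hl
    have h2 : (0 : ℝ) ≤ (B : ℝ) - (s + 1 : ℕ) := by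
      rw [sub_nonneg]; exact_mod_cast Nat.succ_le_of_lt hs
    have : 0 ≤ ((L : ℝ) - l) / L ^ 2 + ((B : ℝ) - (s + 1 : ℕ)) / B ^ 2 := by positivity
    linarith
  have hd2 : d ≤ (ε + d ^ 2 / ε) / 2 := by
    have : ε + d ^ 2 / ε - 2 * d = (ε - d) ^ 2 / ε := by field_simp; ring
    have : 0 ≤ (ε - d) ^ 2 / ε := by positivity
    linarith
  have hd3 : d ^ 2 / ε ≤ quadPot L B l (s + 1) / ε := by gcongr
  have hd4 : ((B : ℝ) - s) / B = d + ((L : ℝ) - l) / L + 1 / B := by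
    rw [hd]; push_cast; field_simp; ring
  unfold pot
  linarith

theorem max_add_le {a b c : ℝ} (hc : 0 ≤ c) : max a (b + c) ≤ max a b + c :=
  max_le (by linarith [le_max_left a b]) (by linarith [le_max_right a b])

/-- The potential does not increase in expectation in one round, even if the algorithm may
exchange it, upon seeing a record, for the value `e (l + 1) / L` of accepting that record. -/
theorem pot_step {L B l s : ℕ} {ε : ℝ} (hL : 0 < L) (hB : 0 < B) (hε : 0 < ε) (hl : l ≤ L)
    (hs : s ≤ B) (hN : (0 : ℝ) < (L : ℝ) + B - (l + s)) :
    ((L : ℝ) - l) / ((L : ℝ) + B - (l + s)) *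
      (1 / ((l : ℝ) + 1) * max (Real.exp 1 * (l + 1) / L) (pot L B ε (l + 1) s) +
        l / ((l : ℝ) + 1) * pot L B ε (l + 1) s) +
      ((B : ℝ) - s) / ((L : ℝ) + B - (l + s)) * pot L B ε l (s + 1) ≤ pot L B ε l s := by
  have hq := quadPot_step (l := l) (s := s) hL hB hN
  set p : ℝ := ((L : ℝ) - l) / ((L : ℝ) + B - (l + s)) with hp
  set q : ℝ := ((B : ℝ) - s) / ((L : ℝ) + B - (l + s)) with hqdef
  have hpq : p + q = 1 := by
    rw [hp, hqdef]; field_simp; ring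
  have h1 : (0 : ℝ) ≤ (L : ℝ) - l := by rw [sub_nonneg]; exact_mod_cast hl
  have hp0 : 0 ≤ p := by positivity
  have hD : p * ((ε + quadPot L B (l + 1) s / ε) / 2) + q * ((ε + quadPot L B l (s + 1) / ε) / 2) ≤
      (ε + quadPot L B l s / ε) / 2 := by
    have : (p * quadPot L B (l + 1) s + q * quadPot L B l (s + 1)) / ε ≤
        quadPot L B l s / ε := by gcongr
    have e : p * ((ε + quadPot L B (l + 1) s / ε) / 2) +
        q * ((ε + quadPot L B l (s + 1) / ε) / 2) =
        ((p + q) * ε + (p * quadPot L B (l + 1) s + q * quadPot L B l (s + 1)) / ε) / 2 := by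
      field_simp
      ring
    rw [e, hpq]
    linarith
  rcases hl.eq_or_lt with hlL | hlL
  · have hp' : p = 0 := by rw [hp, hlL]; simp
    have hq' : q = 1 := by linarith
    rw [hp', hq'] at hD ⊢
    unfold pot
    linarith
  · set D := (ε + quadPot L B (l + 1) s / ε) / 2 with hDdef
    have hD0 : 0 ≤ D := by
      have := quadPot_nonneg (L := L) (B := B) (l := l + 1) (s := s) hlL hs
      positivity
    have hw := wPot_step hlL
    have hB0 : (0 : ℝ) ≤ 1 / B := by positivity
    have hpot : pot L B ε (l + 1) s = wPot L (l + 1) + (1 / B + D) := by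
      rw [pot, hDdef]; ring
    have hmax : max (Real.exp 1 * (l + 1) / L) (pot L B ε (l + 1) s) ≤
        max (Real.exp 1 * (l + 1) / L) (wPot L (l + 1)) + (1 / B + D) := by
      rw [hpot]; exact max_add_le (by linarith)
    have h2 : 1 / ((l : ℝ) + 1) * max (Real.exp 1 * (l + 1) / L) (pot L B ε (l + 1) s) +
        l / ((l : ℝ) + 1) * pot L B ε (l + 1) s ≤ wPot L l + (1 / B + D) := by
      calc _ ≤ 1 / ((l : ℝ) + 1) *
            (max (Real.exp 1 * (l + 1) / L) (wPot L (l + 1)) + (1 / B + D)) +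
            l / ((l : ℝ) + 1) * (wPot L (l + 1) + (1 / B + D)) := by
            rw [← hpot]; gcongr
        _ = (1 / ((l : ℝ) + 1) * max (Real.exp 1 * (l + 1) / L) (wPot L (l + 1)) +
            l / ((l : ℝ) + 1) * wPot L (l + 1)) + (1 / B + D) := by
            field_simp; ring
        _ ≤ _ := by linarith
    calc _ ≤ p * (wPot L l + (1 / B + D)) + q * pot L B ε l (s + 1) := by gcongr
      _ = (p + q) * (wPot L l + 1 / B) +
          (p * D + q * ((ε + quadPot L B l (s + 1) / ε) / 2)) := by
          rw [pot]; ring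
      _ ≤ _ := by rw [hpq, pot]; linarith

theorem pot_zero_le {L B : ℕ} (hB : 0 < B) (hLB : B ≤ L) :
    pot L B (Real.sqrt (2 / B)) 0 0 ≤
      1 + (Real.exp 1 + 1) / B + Real.sqrt (2 / B) := by
  have hB' : (0 : ℝ) < B := by exact_mod_cast hB
  have hLB' : (B : ℝ) ≤ L := by exact_mod_cast hLB
  have hL' : (0 : ℝ) < L := hB'.trans_le hLB'
  have hε : 0 < Real.sqrt (2 / B) := Real.sqrt_pos.mpr (by positivity)
  have hsq : Real.sqrt (2 / B) * Real.sqrt (2 / B) = 2 / B := Real.mul_self_sqrt (by positivity)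
  have hQ : quadPot L B 0 0 ≤ 2 / B := by
    have e : quadPot L B 0 0 = 1 / L + 1 / B := by
      unfold quadPot; push_cast; field_simp; ring
    have : 1 / (L : ℝ) ≤ 1 / B := one_div_le_one_div_of_le hB' hLB'
    have : (2 : ℝ) / B = 1 / B + 1 / B := by ring
    rw [e]; linarith
  have hQ' : quadPot L B 0 0 / Real.sqrt (2 / B) ≤ Real.sqrt (2 / B) := by
    rw [div_le_iff₀ hε, hsq]; exact hQ
  have hw : wPot L 0 ≤ 1 + Real.exp 1 / B := by
    rw [wPot, secretaryValue, if_pos (by simp)]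
    gcongr
  have : (Real.exp 1 + 1) / B = Real.exp 1 / B + 1 / B := by ring
  unfold pot
  linarith

/-! ### The supermartingale -/

theorem SamePast.mono {L t u : ℕ} {σ τ : Equiv.Perm (Fin n)} (h : SamePast L t σ τ) (hu : u ≤ t) :
    SamePast L u σ τ :=
  ⟨fun i hi => h.1 i (hi.trans_le hu), fun i j hi hj => h.2 i j (hi.trans_le hu) (hj.trans_le hu)⟩

theorem PastMeas.add {L t : ℕ} {f g : Equiv.Perm (Fin n) → ℝ} (hf : PastMeas L t f)
    (hg : PastMeas L t g) : PastMeas L t fun σ => f σ + g σ := by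
  intro σ τ h
  simp only [hf σ τ h, hg σ τ h]

/-- The law of one round given its ordinal past: a new record, a large item that is no record, or
a small item. -/
theorem expect_round {L : ℕ} (hL : L ≤ n) (t : Fin n) {f₁ f₂ f₃ : Equiv.Perm (Fin n) → ℝ}
    (h₁ : PastMeas L t f₁) (h₂ : PastMeas L t f₂) (h₃ : PastMeas L t f₃) :
    𝔼 σ, (f₁ σ * ind (IsRecord L t σ) +
        f₂ σ * (ind ((σ t : ℕ) < L) - ind (IsRecord L t σ)) + f₃ σ * (1 - ind ((σ t : ℕ) < L))) =
      𝔼 σ, (((L : ℝ) - seen L t σ) / ((n : ℝ) - t) *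
          (1 / ((seen L t σ : ℝ) + 1) * f₁ σ + seen L t σ / ((seen L t σ : ℝ) + 1) * f₂ σ) +
        (1 - ((L : ℝ) - seen L t σ) / ((n : ℝ) - t)) * f₃ σ) := by
  have hneg : PastMeas L t fun σ => f₁ σ + (-1) * f₂ σ :=
    h₁.add (PastMeas.mul (f := fun _ => -1) (fun _ _ _ => rfl) h₂)
  have hrec := expect_mul_ind_record t hneg
  set g : Equiv.Perm (Fin n) → ℝ := fun σ =>
    (f₁ σ + (-1) * f₂ σ) * (1 / ((seen L t σ : ℝ) + 1)) + f₂ σ + (-1) * f₃ σ with hg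
  have hgm : PastMeas L t g :=
    ((hneg.mul (PastMeas.comp_seen fun l => 1 / ((l : ℝ) + 1))).add h₂).add
      (PastMeas.mul (f := fun _ => -1) (fun _ _ _ => rfl) h₃)
  have hlarge := expect_mul_ind_large hL t hgm
  calc _ = 𝔼 σ, (f₁ σ + (-1) * f₂ σ) * ind (IsRecord L t σ) +
        𝔼 σ, (f₂ σ * ind ((σ t : ℕ) < L) + f₃ σ * (1 - ind ((σ t : ℕ) < L))) := by
        rw [← Finset.expect_add_distrib]
        exact Finset.expect_congr rfl fun σ _ => by ring
    _ = 𝔼 σ, g σ * ind ((σ t : ℕ) < L) + 𝔼 σ, f₃ σ := by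
        rw [hrec, ← Finset.expect_add_distrib, ← Finset.expect_add_distrib]
        exact Finset.expect_congr rfl fun σ _ => by rw [hg]; ring
    _ = _ := by
        rw [hlarge, ← Finset.expect_add_distrib]
        refine Finset.expect_congr rfl fun σ _ => ?_
        have : (seen L t σ : ℝ) + 1 ≠ 0 := by positivity
        rw [hg]
        field_simp
        ring

/-- Nothing has been accepted in the first `t` rounds. -/
def NoneBefore (acc : Fin n → Equiv.Perm (Fin n) → Prop) (t : ℕ) (σ : Equiv.Perm (Fin n)) : Prop :=
  ∀ i : Fin n, (i : ℕ) < t → ¬ acc i σ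

/-- The best of the first `t` arrivals is large and has been accepted. -/
def BestAccepted (L : ℕ) (acc : Fin n → Equiv.Perm (Fin n) → Prop) (t : ℕ)
    (σ : Equiv.Perm (Fin n)) : Prop :=
  ∃ i : Fin n, (i : ℕ) < t ∧ acc i σ ∧ (σ i : ℕ) < L ∧ ∀ j : Fin n, (j : ℕ) < t → ¬ σ j < σ i

theorem pastMeas_noneBefore {L : ℕ} {acc : Fin n → Equiv.Perm (Fin n) → Prop}
    (hacc : ∀ t : Fin n, PastMeas L (t + 1) (acc t)) (t : ℕ) :
    PastMeas L t fun σ => ind (NoneBefore acc t σ) := by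
  intro σ τ h
  simp only
  congr 1
  refine propext (forall_congr' fun i => imp_congr_right fun hi => ?_)
  rw [hacc i σ τ (h.mono hi)]

theorem pastMeas_bestAccepted {L : ℕ} {acc : Fin n → Equiv.Perm (Fin n) → Prop}
    (hacc : ∀ t : Fin n, PastMeas L (t + 1) (acc t)) (t : ℕ) :
    PastMeas L t fun σ => ind (BestAccepted L acc t σ) := by
  intro σ τ h
  simp only
  congr 1
  refine propext (exists_congr fun i => and_congr_right fun hi => ?_)
  rw [hacc i σ τ (h.mono hi), h.1 i hi]
  refine and_congr_right fun _ => and_congr_right fun _ => forall_congr' fun j =>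
    imp_congr_right fun hj => ?_
  rw [h.2 j i hj hi]

theorem card_small_from {L : ℕ} (hL : L ≤ n) (t : ℕ) (ht : t ≤ n) (σ : Equiv.Perm (Fin n)) :
    (Finset.univ.filter fun i : Fin n => t ≤ (i : ℕ) ∧ ¬ (σ i : ℕ) < L).card
      + (t - seen L t σ) = n - L := by
  have h1 := seen_add_card (t := t) hL σ
  have h2 := seen_le (L := L) (t := t) σ
  have h3 : (Finset.univ.filter fun i : Fin n => t ≤ (i : ℕ)).card = n - t := by
    have h := Finset.card_filter_add_card_filter_not (s := (Finset.univ : Finset (Fin n)))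
      (fun i => (i : ℕ) < t)
    rw [card_filter_val_lt ht, Finset.card_univ, Fintype.card_fin] at h
    simp only [not_lt] at h
    omega
  have h4 := Finset.card_filter_add_card_filter_not
    (s := Finset.univ.filter fun i : Fin n => t ≤ (i : ℕ)) (fun i => (σ i : ℕ) < L)
  rw [Finset.filter_filter, Finset.filter_filter, h3] at h4
  omega

/-- The supermartingale: the potential while nothing has been accepted, `e` times the conditional
probability that an accepted leading item stays the best one, and the fraction of small items that
still remains when the first small item is accepted. -/
noncomputable def gain (L B : ℕ) (ε : ℝ) (acc : Fin n → Equiv.Perm (Fin n) → Prop) (t : ℕ)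
    (σ : Equiv.Perm (Fin n)) : ℝ :=
  ind (NoneBefore acc t σ) * pot L B ε (seen L t σ) (t - seen L t σ) +
    Real.exp 1 / L * seen L t σ * ind (BestAccepted L acc t σ) +
    ∑ u ∈ Finset.univ.filter (fun u : Fin n => (u : ℕ) < t),
      ind (NoneBefore acc u σ) * ind (acc u σ) * (1 - ind ((σ u : ℕ) < L)) *
        (((B : ℝ) - ((u - seen L u σ : ℕ) : ℝ)) / B)

/-- The gain after one more round, bounded separately according to whether the new arrival is a
record, another large item or a small item. The algorithm's decision has been replaced by the best
one, so that all coefficients depend on the ordinal past only. -/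
theorem gain_succ_le {L B : ℕ} {ε : ℝ} (hL : 0 < L) (hB : 0 < B) (hε : 0 < ε) (hn : n = L + B)
    {acc : Fin n → Equiv.Perm (Fin n) → Prop}
    (hfeas : ∀ σ t u, acc t σ → acc u σ → (σ t : ℕ) < L → t = u) (t : Fin n)
    (σ : Equiv.Perm (Fin n)) :
    gain L B ε acc (t + 1) σ ≤
      (ind (NoneBefore acc t σ) * max (Real.exp 1 * ((seen L t σ : ℝ) + 1) / L)
          (pot L B ε (seen L t σ + 1) (t - seen L t σ))) * ind (IsRecord L t σ) +
        (ind (NoneBefore acc t σ) * pot L B ε (seen L t σ + 1) (t - seen L t σ) +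
          ind (BestAccepted L acc t σ) * (Real.exp 1 / L * ((seen L t σ : ℝ) + 1))) *
          (ind ((σ t : ℕ) < L) - ind (IsRecord L t σ)) +
        (ind (NoneBefore acc t σ) * pot L B ε (seen L t σ) (t - seen L t σ + 1) +
          ind (BestAccepted L acc t σ) * (Real.exp 1 / L * seen L t σ)) *
          (1 - ind ((σ t : ℕ) < L)) +
        ∑ u ∈ Finset.univ.filter (fun u : Fin n => (u : ℕ) < t),
          ind (NoneBefore acc u σ) * ind (acc u σ) * (1 - ind ((σ u : ℕ) < L)) *
            (((B : ℝ) - ((u - seen L u σ : ℕ) : ℝ)) / B) := by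
  classical
  have hLn : L ≤ n := by omega
  have hlt := seen_le (L := L) (t := t) σ
  have hnone : ind (NoneBefore acc (t + 1) σ) =
      ind (NoneBefore acc t σ) * (1 - ind (acc t σ)) := by
    rw [← ind_not, ← ind_and]
    congr 1
    refine propext ⟨fun h => ⟨fun i hi => h i (by omega), h t (by omega)⟩, ?_⟩
    rintro ⟨h1, h2⟩ i hi
    rcases (Nat.lt_succ_iff_lt_or_eq.mp hi) with h | h
    · exact h1 i h
    · rw [Fin.ext h]; exact h2
  have hbest : ind (BestAccepted L acc (t + 1) σ) ≤
      ind (BestAccepted L acc t σ) * (1 - ind (IsRecord L t σ)) +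
        ind (NoneBefore acc t σ) * ind (acc t σ) * ind (IsRecord L t σ) := by
    have hnn : 0 ≤ ind (BestAccepted L acc t σ) * (1 - ind (IsRecord L t σ)) :=
      mul_nonneg (ind_nonneg _) (sub_nonneg.mpr (ind_le_one _))
    have hnn' : 0 ≤ ind (NoneBefore acc t σ) * ind (acc t σ) * ind (IsRecord L t σ) :=
      mul_nonneg (mul_nonneg (ind_nonneg _) (ind_nonneg _)) (ind_nonneg _)
    by_cases h : BestAccepted L acc (t + 1) σ
    · rw [ind_true h]
      obtain ⟨i, hi, hai, hiL, hmin⟩ := h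
      rcases (Nat.lt_succ_iff_lt_or_eq.mp hi) with h | h
      · have h1 : BestAccepted L acc t σ := ⟨i, h, hai, hiL, fun j hj => hmin j (by omega)⟩
        have h2 : ¬ IsRecord L t σ := fun hr => hmin t (by omega) (hr.2 i h)
        rw [ind_true h1, ind_false h2]
        linarith [ind_nonneg (acc t σ)]
      · obtain rfl : i = t := Fin.ext h
        have h1 : NoneBefore acc i σ := fun j hj haj => by
          have := hfeas σ i j hai haj hiL
          rw [this] at hj; omega
        have h2 : IsRecord L i σ := by
          refine ⟨hiL, fun j hj => lt_of_le_of_ne (not_lt.mp (hmin j ?_)) fun h => ?_⟩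
          · have : (j : ℕ) < i := hj
            omega
          · exact hj.ne (σ.injective h.symm)
        rw [ind_true h1, ind_true h2, ind_true hai]
        rw [ind_true h2] at hnn
        linarith
    · rw [ind_false h]; linarith
  have hsum : (Finset.univ.filter fun u : Fin n => (u : ℕ) < t + 1) =
      insert t (Finset.univ.filter fun u : Fin n => (u : ℕ) < t) := by
    ext u
    simp only [Finset.mem_filter, Finset.mem_univ, true_and, Finset.mem_insert, Fin.ext_iff]
    omega
  have hs := card_small_from hLn t t.isLt.le σ
  unfold gain
  rw [hsum, Finset.sum_insert (by simp), hnone]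
  set S := ∑ u ∈ Finset.univ.filter (fun u : Fin n => (u : ℕ) < t),
          ind (NoneBefore acc u σ) * ind (acc u σ) * (1 - ind ((σ u : ℕ) < L)) *
            (((B : ℝ) - ((u - seen L u σ : ℕ) : ℝ)) / B)
  set f := ind (NoneBefore acc t σ) with hf
  set g := ind (BestAccepted L acc t σ)
  set a := ind (acc t σ) with ha
  have hf0 : 0 ≤ f := ind_nonneg _
  have ha01 : a = 0 ∨ a = 1 := by
    by_cases h : acc t σ
    · right; exact ind_true h
    · left; exact ind_false h
  rw [seen_succ]
  by_cases hlarge : (σ t : ℕ) < L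
  · rw [if_pos hlarge, ind_true hlarge]
    have hseen : seen L t σ + 1 ≤ L := by
      have := seen_le_large (t := t + 1) hLn σ
      rwa [seen_succ, if_pos hlarge] at this
    have e1 : (t : ℕ) + 1 - (seen L t σ + 1) = t - seen L t σ := by omega
    rw [e1]
    push_cast
    set l := seen L t σ
    set s := (t : ℕ) - l
    have hP : 0 ≤ pot L B ε (l + 1) s := pot_nonneg hL hε hseen (by omega)
    set P := pot L B ε (l + 1) s
    set M := max (Real.exp 1 * ((l : ℝ) + 1) / L) P with hM
    have hM1 : Real.exp 1 * ((l : ℝ) + 1) / L ≤ M := le_max_left _ _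
    have hM2 : P ≤ M := le_max_right _ _
    set c := Real.exp 1 / L * ((l : ℝ) + 1) with hc
    have hc' : Real.exp 1 * ((l : ℝ) + 1) / L = c := by rw [hc]; ring
    rw [hc'] at hM1
    have hc0 : 0 ≤ c := by positivity
    have hb := mul_le_mul_of_nonneg_left hbest hc0
    set rc := ind (IsRecord L t σ) with hrc
    have hrc01 : rc = 0 ∨ rc = 1 := by
      by_cases h : IsRecord L t σ
      · right; exact ind_true h
      · left; exact ind_false h
    have key : f * ((1 - a) * P + a * rc * c) ≤ f * (rc * M + (1 - rc) * P) := by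
      refine mul_le_mul_of_nonneg_left ?_ hf0
      rcases ha01 with h | h <;> rcases hrc01 with h' | h' <;> rw [h, h'] <;> linarith
    linarith
  · rw [if_neg hlarge, ind_false hlarge]
    have hrec : ¬ IsRecord L t σ := fun h => hlarge h.1
    rw [ind_false hrec] at hbest ⊢
    have hpos :
        0 < (Finset.univ.filter fun i : Fin n => (t : ℕ) ≤ (i : ℕ) ∧ ¬ (σ i : ℕ) < L).card :=
      Finset.card_pos.mpr ⟨t, by simpa using hlarge⟩
    have e1 : (t : ℕ) + 1 - (seen L t σ + 0) = t - seen L t σ + 1 := by omega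
    rw [e1, add_zero]
    set l := seen L t σ with hl
    have hsmall := small_le_pot (l := l) (s := t - l) hL hB hε (seen_le_large hLn σ) (by omega)
    set s := (t : ℕ) - l
    set P := pot L B ε l (s + 1)
    have hb := mul_le_mul_of_nonneg_left hbest (show 0 ≤ Real.exp 1 / L * (l : ℝ) by positivity)
    have key : f * ((1 - a) * P + a * (((B : ℝ) - s) / B)) ≤ f * P := by
      refine mul_le_mul_of_nonneg_left ?_ hf0
      rcases ha01 with h | h <;> rw [h] <;> linarith
    linarith

/-- The expected gain does not increase. -/
theorem expect_gain_succ_le {L B : ℕ} {ε : ℝ} (hL : 0 < L) (hB : 0 < B) (hε : 0 < ε)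
    (hn : n = L + B) {acc : Fin n → Equiv.Perm (Fin n) → Prop}
    (hacc : ∀ t : Fin n, PastMeas L (t + 1) (acc t))
    (hfeas : ∀ σ t u, acc t σ → acc u σ → (σ t : ℕ) < L → t = u) (t : Fin n) :
    𝔼 σ, gain L B ε acc (t + 1) σ ≤ 𝔼 σ, gain L B ε acc t σ := by
  have hLn : L ≤ n := by omega
  refine (expect_mono (gain_succ_le hL hB hε hn hfeas t)).trans ?_
  have hN := pastMeas_noneBefore hacc t
  have hA := pastMeas_bestAccepted hacc t
  rw [Finset.expect_add_distrib, expect_round hLn t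
    (hN.mul (PastMeas.comp_seen fun l => max (Real.exp 1 * ((l : ℝ) + 1) / L)
          (pot L B ε (l + 1) (t - l))))
    ((hN.mul (PastMeas.comp_seen fun l => pot L B ε (l + 1) (t - l))).add
      (hA.mul (PastMeas.comp_seen fun l => Real.exp 1 / L * ((l : ℝ) + 1))))
    ((hN.mul (PastMeas.comp_seen fun l => pot L B ε l (t - l + 1))).add
      (hA.mul (PastMeas.comp_seen fun l => Real.exp 1 / L * (l : ℝ)))),
    ← Finset.expect_add_distrib]
  refine expect_mono fun σ => ?_
  unfold gain
  refine add_le_add ?_ le_rfl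
  have hlt := seen_le (L := L) (t := t) σ
  have hs := card_small_from hLn t t.isLt.le σ
  have hlL := seen_le_large (t := t) hLn σ
  have hcast : (((t : ℕ) - seen L t σ : ℕ) : ℝ) = (t : ℝ) - seen L t σ := by
    rw [Nat.cast_sub hlt]
  set l := seen L t σ
  have hn' : (n : ℝ) = L + B := by rw [hn]; push_cast; rfl
  have htn : (t : ℝ) < n := by exact_mod_cast t.isLt
  have hNpos : (0 : ℝ) < (L : ℝ) + B - (l + ((t - l : ℕ) : ℝ)) := by rw [hcast]; linarith
  have hstep := pot_step (s := t - l) hL hB hε hlL (by omega) hNpos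
  have hden : (L : ℝ) + B - (l + ((t - l : ℕ) : ℝ)) = n - t := by rw [hcast, hn']; ring
  rw [hden] at hstep hNpos
  have hq : ((B : ℝ) - ((t - l : ℕ) : ℝ)) / ((n : ℝ) - t) = 1 - ((L : ℝ) - l) / ((n : ℝ) - t) := by
    rw [hcast, hn']
    rw [hn'] at hNpos
    field_simp
    ring
  rw [hq] at hstep
  set p := ((L : ℝ) - l) / ((n : ℝ) - t)
  set f := ind (NoneBefore acc t σ)
  set g := ind (BestAccepted L acc t σ)
  have hf0 : 0 ≤ f := ind_nonneg _
  have h1 := mul_le_mul_of_nonneg_left hstep hf0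
  set M := max (Real.exp 1 * ((l : ℝ) + 1) / L) (pot L B ε (l + 1) (t - l))
  have hg : (l : ℝ) / ((l : ℝ) + 1) * (g * (Real.exp 1 / L * ((l : ℝ) + 1))) =
      g * (Real.exp 1 / L * l) := by
    field_simp
  have e : p * (1 / ((l : ℝ) + 1) * (f * M) + l / ((l : ℝ) + 1) *
      (f * pot L B ε (l + 1) (t - l) + g * (Real.exp 1 / L * ((l : ℝ) + 1)))) +
      (1 - p) * (f * pot L B ε l (t - l + 1) + g * (Real.exp 1 / L * l)) =
      f * (p * (1 / ((l : ℝ) + 1) * M + l / ((l : ℝ) + 1) * pot L B ε (l + 1) (t - l)) +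
        (1 - p) * pot L B ε l (t - l + 1)) + g * (Real.exp 1 / L * l) := by
    rw [mul_add (_ / _) (f * _), hg]
    ring
  rw [e]
  linarith

/-- The final gain dominates the objective. -/
theorem objective_le_gain {L B : ℕ} {ε : ℝ} (hL : 0 < L) (hB : 0 < B) (hε : 0 < ε)
    (hn : n = L + B) {acc : Fin n → Equiv.Perm (Fin n) → Prop}
    (hfeas : ∀ σ t u, acc t σ → acc u σ → (σ t : ℕ) < L → t = u) (σ : Equiv.Perm (Fin n)) :
    Real.exp 1 * ind (∃ t, acc t σ ∧ (σ t : ℕ) = 0) +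
      (∑ t, ind (acc t σ ∧ ¬ (σ t : ℕ) < L)) / B ≤ gain L B ε acc n σ := by
  classical
  have hLn : L ≤ n := by omega
  have hB' : (0 : ℝ) < B := by exact_mod_cast hB
  have hL' : (0 : ℝ) < L := by exact_mod_cast hL
  have hseen : seen L n σ = L := by
    have h := seen_add_card (t := n) hLn σ
    rw [Finset.filter_false_of_mem, Finset.card_empty] at h
    · omega
    · rintro i - ⟨h1, -⟩
      have := i.isLt
      omega
  have h0 : 0 ≤ ind (NoneBefore acc n σ) * pot L B ε (seen L n σ) (n - seen L n σ) :=
    mul_nonneg (ind_nonneg _) (pot_nonneg hL hε (by omega) (by omega))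
  have h1 : Real.exp 1 * ind (∃ t, acc t σ ∧ (σ t : ℕ) = 0) ≤
      Real.exp 1 / L * seen L n σ * ind (BestAccepted L acc n σ) := by
    rw [hseen, div_mul_cancel₀ _ hL'.ne']
    refine mul_le_mul_of_nonneg_left (ind_mono ?_) (Real.exp_pos 1).le
    rintro ⟨t, hat, ht⟩
    refine ⟨t, t.isLt, hat, by omega, fun j _ hj => ?_⟩
    have : (σ j : ℕ) < σ t := hj
    omega
  have hterm : ∀ u : Fin n, 0 ≤ ind (NoneBefore acc u σ) * ind (acc u σ) *
      (1 - ind ((σ u : ℕ) < L)) * (((B : ℝ) - ((u - seen L u σ : ℕ) : ℝ)) / B) := by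
    intro u
    have := card_small_from hLn u u.isLt.le σ
    have h : (((u : ℕ) - seen L u σ : ℕ) : ℝ) ≤ B := by
      have : (u : ℕ) - seen L u σ ≤ B := by omega
      exact_mod_cast this
    exact mul_nonneg (mul_nonneg (mul_nonneg (ind_nonneg _) (ind_nonneg _))
      (sub_nonneg.mpr (ind_le_one _))) (div_nonneg (by linarith) hB'.le)
  have h2 : (∑ t, ind (acc t σ ∧ ¬ (σ t : ℕ) < L)) / B ≤
      ∑ u ∈ Finset.univ.filter (fun u : Fin n => (u : ℕ) < n),
        ind (NoneBefore acc u σ) * ind (acc u σ) * (1 - ind ((σ u : ℕ) < L)) *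
          (((B : ℝ) - ((u - seen L u σ : ℕ) : ℝ)) / B) := by
    rw [sum_ind]
    set A := Finset.univ.filter fun t => acc t σ ∧ ¬ (σ t : ℕ) < L with hA
    rcases A.eq_empty_or_nonempty with h | ⟨v, hv⟩
    · rw [h]
      simp only [Finset.card_empty, Nat.cast_zero, zero_div]
      exact Finset.sum_nonneg fun u _ => hterm u
    · rw [hA, Finset.mem_filter] at hv
      obtain ⟨u, hu, humin⟩ := Finset.exists_min_image
        (Finset.univ.filter fun t => acc t σ) id ⟨v, by simpa using hv.2.1⟩
      simp only [Finset.mem_filter, Finset.mem_univ, true_and, id] at hu humin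
      have huS : ¬ (σ u : ℕ) < L := by
        intro h
        rw [← hfeas σ u v hu hv.2.1 h] at hv
        exact hv.2.2 h
      have hnone : NoneBefore acc u σ := fun i hi hai => by
        have : (u : ℕ) ≤ i := humin i hai
        omega
      refine le_trans ?_ (Finset.single_le_sum (fun u _ => hterm u)
        (Finset.mem_filter.mpr ⟨Finset.mem_univ u, u.isLt⟩))
      rw [ind_true hu, ind_true hnone, ind_false huS]
      have hcard := card_small_from hLn u u.isLt.le σ
      have hle : A.card ≤
          (Finset.univ.filter fun i : Fin n => (u : ℕ) ≤ (i : ℕ) ∧ ¬ (σ i : ℕ) < L).card := by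
        refine Finset.card_le_card fun i hi => ?_
        rw [hA, Finset.mem_filter] at hi
        rw [Finset.mem_filter]
        exact ⟨hi.1, humin i hi.2.1, hi.2.2⟩
      have hle' : (A.card : ℝ) + (((u : ℕ) - seen L u σ : ℕ) : ℝ) ≤ B := by
        have : A.card + ((u : ℕ) - seen L u σ) ≤ B := by omega
        exact_mod_cast this
      rw [sub_zero, one_mul, one_mul, one_mul]
      gcongr
      linarith
  unfold gain
  linarith

/-- The trade-off between accepting the best item and accepting many small items. -/
theorem tradeoff {L B : ℕ} (hB : 0 < B) (hLB : B ≤ L) (hn : n = L + B)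
    {acc : Fin n → Equiv.Perm (Fin n) → Prop}
    (hacc : ∀ t : Fin n, PastMeas L (t + 1) (acc t))
    (hfeas : ∀ σ t u, acc t σ → acc u σ → (σ t : ℕ) < L → t = u) :
    Real.exp 1 * 𝔼 σ, ind (∃ t, acc t σ ∧ (σ t : ℕ) = 0) +
      (𝔼 σ, ∑ t, ind (acc t σ ∧ ¬ (σ t : ℕ) < L)) / B ≤
      1 + (Real.exp 1 + 1) / B + Real.sqrt (2 / B) := by
  have hL : 0 < L := by omega
  have hε : 0 < Real.sqrt (2 / B) := Real.sqrt_pos.mpr (by positivity)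
  refine le_trans ?_ (pot_zero_le hB hLB)
  set ε := Real.sqrt (2 / B)
  have hind : ∀ t : ℕ, t ≤ n → 𝔼 σ, gain L B ε acc t σ ≤ pot L B ε 0 0 := by
    intro t
    induction t with
    | zero =>
      intro _
      rw [← Fintype.expect_const (ι := Equiv.Perm (Fin n)) (pot L B ε 0 0)]
      refine (Finset.expect_congr rfl fun σ _ => ?_).le
      have h1 : NoneBefore acc 0 σ := fun i hi => absurd hi (by omega)
      have h2 : ¬ BestAccepted L acc 0 σ := by rintro ⟨i, hi, -⟩; omega
      have h3 : seen L 0 σ = 0 := Nat.le_zero.mp (seen_le σ)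
      simp [gain, ind_true h1, ind_false h2, h3]
    | succ t ih =>
      intro ht
      exact (expect_gain_succ_le hL hB hε hn hacc hfeas ⟨t, ht⟩).trans (ih (by omega))
  refine le_trans ?_ (hind n le_rfl)
  rw [Finset.mul_expect, Finset.expect_div, ← Finset.expect_add_distrib]
  exact expect_mono (objective_le_gain hL hB hε hn hfeas)

/-! ### The upper bound on the competitive ratio -/

theorem Inst.value_lt_iff (I : Inst B n) {i j : Fin n} : I.value i < I.value j ↔ j < i :=
  I.value_strictAnti.lt_iff_gt

theorem Inst.view_better (I : Inst B n) (σ : ArrivalOrder n) (t : Fin n) (i j : Fin (t + 1)) :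
    (I.view σ t).better i j = true ↔ σ (Fin.castLE t.isLt i) < σ (Fin.castLE t.isLt j) := by
  simp [Inst.view, I.value_lt_iff]

theorem Inst.view_isLarge (I : Inst B n) (σ : ArrivalOrder n) (t : Fin n) (i : Fin (t + 1)) :
    (I.view σ t).isLarge i = I.isLarge (σ (Fin.castLE t.isLt i)) := rfl

theorem Inst.view_eq {I J : Inst B n} {σ τ : ArrivalOrder n} {t : Fin n}
    (h1 : ∀ i : Fin n, (i : ℕ) < t + 1 → I.isLarge (σ i) = J.isLarge (τ i))
    (h2 : ∀ i j : Fin n, (i : ℕ) < t + 1 → (j : ℕ) < t + 1 → (σ i < σ j ↔ τ i < τ j)) :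
    I.view σ t = J.view τ t := by
  have e1 : (I.view σ t).isLarge = (J.view τ t).isLarge := by
    funext i
    exact h1 _ i.isLt
  have e2 : (I.view σ t).better = (J.view τ t).better := by
    funext i j
    rw [Bool.eq_iff_iff, Inst.view_better, Inst.view_better]
    exact h2 _ _ i.isLt j.isLt
  have ext : ∀ v w : OrdinalView (t + 1), v.isLarge = w.isLarge → v.better = w.better → v = w := by
    rintro ⟨a, b⟩ ⟨c, d⟩ rfl rfl
    rfl
  exact ext _ _ e1 e2

theorem Inst.le_opt (I : Inst B n) {S : Finset (Fin n)} (h : I.Feasible S) :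
    I.totalValue S ≤ I.opt := by
  classical
  exact Finset.le_sup' I.totalValue (Finset.mem_filter.mpr ⟨Finset.mem_univ S, h⟩)

theorem mem_accepted {d : DecisionRule n} {I : Inst B n} {σ : ArrivalOrder n} {t : Fin n} :
    σ t ∈ d.accepted I σ ↔ d t (I.view σ t) = true := by
  rw [DecisionRule.accepted, Finset.mem_filter, Equiv.symm_apply_apply]
  simp

theorem sum_accepted (d : DecisionRule n) (I : Inst B n) (σ : ArrivalOrder n) (g : Fin n → ℝ) :
    ∑ i ∈ d.accepted I σ, g i = ∑ t, ind (d t (I.view σ t) = true) * g (σ t) := by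
  classical
  rw [← Equiv.sum_comp σ.symm, DecisionRule.accepted, Finset.sum_filter]
  refine Finset.sum_congr rfl fun i _ => ?_
  rw [Equiv.apply_symm_apply]
  by_cases h : d (σ.symm i) (I.view σ (σ.symm i)) = true
  · rw [if_pos h, ind_true h, one_mul]
  · rw [if_neg h, ind_false h, zero_mul]

theorem sum_toReal_eq_one (A : OrdinalAlgorithm B n) : ∑ d, (A d).toReal = 1 := by
  have h := A.tsum_coe
  rw [tsum_fintype] at h
  rw [← ENNReal.toReal_sum fun d _ => A.apply_ne_top d, h, ENNReal.toReal_one]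

theorem expectedValue_eq (A : OrdinalAlgorithm B n) (I : Inst B n) :
    A.expectedValue I =
      ∑ d : DetAlgorithm B n, (A d).toReal * 𝔼 σ, I.totalValue (d.1.accepted I σ) := by
  simp only [OrdinalAlgorithm.expectedValue, Fintype.expect_eq_sum_div_card]

/-- The instance in which item `0` carries essentially all of the value: the `L` best items are
large, and the items other than the best one have values at most `1 / (n B)`. -/
noncomputable def steepInst (L B n : ℕ) (hB : 0 < B) : Inst B n where
  value i := if (i : ℕ) = 0 then 1 else ((n : ℝ) - i) / ((n : ℝ) ^ 2 * B)
  value_nonneg i := by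
    have h : (i : ℝ) ≤ n := by exact_mod_cast i.isLt.le
    split_ifs
    · exact zero_le_one
    · exact div_nonneg (by linarith) (by positivity)
  value_strictAnti := by
    intro i j hij
    have hn : (0 : ℝ) < n := by exact_mod_cast i.pos
    have hB' : (1 : ℝ) ≤ B := by exact_mod_cast hB
    have hij' : (i : ℕ) < j := hij
    have hj0 : ¬ (j : ℕ) = 0 := by omega
    have hD : 0 < (n : ℝ) ^ 2 * B := by positivity
    simp only [if_neg hj0]
    split_ifs with h
    · rw [div_lt_one hD]
      have h1 : (1 : ℝ) ≤ j := by exact_mod_cast (by omega : 1 ≤ (j : ℕ))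
      have h2 : (1 : ℝ) ≤ n := by exact_mod_cast i.pos
      have h3 : (n : ℝ) ≤ n ^ 2 := by nlinarith
      nlinarith [sq_nonneg (n : ℝ)]
    · have : (i : ℝ) < j := by exact_mod_cast hij'
      gcongr
  isLarge i := decide ((i : ℕ) < L)

/-- The instance with the same ordinal structure as `steepInst` in which all values lie in
`[1 - 1 / B, 1]`. -/
noncomputable def flatInst (L B n : ℕ) (hB : 0 < B) : Inst B n where
  value i := 1 - (i : ℝ) / ((n : ℝ) * B)
  value_nonneg i := by
    have h : (i : ℝ) ≤ n := by exact_mod_cast i.isLt.le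
    have hn : (0 : ℝ) < n := by exact_mod_cast i.pos
    have hB' : (1 : ℝ) ≤ B := by exact_mod_cast hB
    rw [sub_nonneg]
    exact div_le_one_of_le₀ (by nlinarith) (by positivity)
  value_strictAnti := by
    intro i j hij
    have hn : (0 : ℝ) < n := by exact_mod_cast i.pos
    have hB' : (0 : ℝ) < B := by exact_mod_cast hB
    have : (i : ℝ) < j := by exact_mod_cast hij
    simp only
    gcongr
  isLarge i := decide ((i : ℕ) < L)

theorem one_le_opt_steep {L : ℕ} (hB : 0 < B) (hL : 0 < L) (hn : 0 < n) :
    1 ≤ (steepInst L B n hB).opt := by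
  have h := (steepInst L B n hB).le_opt (S := {⟨0, hn⟩}) (by
    simp [Inst.Feasible, Inst.size, steepInst, hL])
  simpa [Inst.totalValue, steepInst] using h

theorem le_opt_flat {L : ℕ} (hB : 0 < B) (hn : n = L + B) :
    (B : ℝ) - 1 ≤ (flatInst L B n hB).opt := by
  have hB' : (0 : ℝ) < B := by exact_mod_cast hB
  have hn' : (0 : ℝ) < n := by exact_mod_cast (by omega : 0 < n)
  set S := Finset.univ.filter fun i : Fin n => ¬ (i : ℕ) < L with hS
  have hcard : S.card = B := by
    have h := Finset.card_filter_add_card_filter_not (s := (Finset.univ : Finset (Fin n)))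
      (fun i => (i : ℕ) < L)
    rw [card_filter_val_lt (by omega), Finset.card_univ, Fintype.card_fin, ← hS] at h
    omega
  refine le_trans ?_ ((flatInst L B n hB).le_opt (S := S) ?_)
  · have : S.card • (1 - 1 / (B : ℝ)) ≤ ∑ i ∈ S, (flatInst L B n hB).value i := by
      refine Finset.card_nsmul_le_sum _ _ _ fun i _ => ?_
      have h : (i : ℝ) ≤ n := by exact_mod_cast i.isLt.le
      have : (i : ℝ) / ((n : ℝ) * B) ≤ 1 / B := by
        rw [div_le_div_iff₀ (by positivity) hB']
        nlinarith
      simp only [flatInst]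
      linarith
    rw [hcard, nsmul_eq_mul, mul_sub, mul_one, mul_one_div_cancel hB'.ne'] at this
    exact this
  · have : ∀ i ∈ S, (flatInst L B n hB).size i = 1 := by
      intro i hi
      rw [hS, Finset.mem_filter] at hi
      simp [Inst.size, flatInst, hi.2]
    rw [Inst.Feasible, Finset.sum_congr rfl this]
    simp [hcard]

/-- A deterministic algorithm cannot do well on both instances: since they look alike, the
trade-off between the best item and the small items applies. -/
theorem det_tradeoff {L : ℕ} (hB : 0 < B) (hLB : B ≤ L) (hn : n = L + B) (d : DetAlgorithm B n) :
    Real.exp 1 * 𝔼 σ, (steepInst L B n hB).totalValue (d.1.accepted (steepInst L B n hB) σ) +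
      (𝔼 σ, (flatInst L B n hB).totalValue (d.1.accepted (flatInst L B n hB) σ)) / B ≤
      1 + (2 * Real.exp 1 + 2) / B + Real.sqrt (2 / B) := by
  classical
  have hB' : (0 : ℝ) < B := by exact_mod_cast hB
  have hn0 : 0 < n := by omega
  have hn' : (0 : ℝ) < n := by exact_mod_cast hn0
  set I := steepInst L B n hB with hI
  set J := flatInst L B n hB with hJ
  have hview : ∀ σ t, J.view σ t = I.view σ t := fun σ t =>
    Inst.view_eq (fun _ _ => rfl) (fun _ _ _ _ => Iff.rfl)
  set acc : Fin n → Equiv.Perm (Fin n) → Prop := fun t σ => d.1 t (I.view σ t) = true with hacc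
  have hmeas : ∀ t : Fin n, PastMeas L (t + 1) (acc t) := by
    intro t σ τ h
    have : I.view σ t = I.view τ t := by
      refine Inst.view_eq (fun i hi => ?_) h.2
      rw [Bool.eq_iff_iff]
      simpa [hI, steepInst] using h.1 i hi
    simp only [hacc, this]
  -- A large item fills the knapsack, so nothing else is accepted along with it.
  have hfeas : ∀ σ t u, acc t σ → acc u σ → (σ t : ℕ) < L → t = u := by
    intro σ t u ht hu htL
    by_contra hne
    have hf := d.2 I σ
    have hsub : ({σ t, σ u} : Finset (Fin n)) ⊆ d.1.accepted I σ := by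
      intro i hi
      rw [Finset.mem_insert, Finset.mem_singleton] at hi
      rcases hi with rfl | rfl
      · exact mem_accepted.mpr ht
      · exact mem_accepted.mpr hu
    have h := Finset.sum_le_sum_of_subset (f := I.size) hsub
    rw [Finset.sum_pair fun h => hne (σ.injective h)] at h
    have h1 : I.size (σ t) = B := by simp [Inst.size, hI, steepInst, htL]
    have h2 : 1 ≤ I.size (σ u) := by
      unfold Inst.size; split_ifs <;> omega
    have h3 : ∑ i ∈ d.1.accepted I σ, I.size i ≤ B := hf
    omega
  have hmain := tradeoff hB hLB hn hmeas hfeas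
  have h1 : 𝔼 σ, I.totalValue (d.1.accepted I σ) ≤
      𝔼 σ, ind (∃ t, acc t σ ∧ (σ t : ℕ) = 0) + 1 / B := by
    rw [← Fintype.expect_const (ι := Equiv.Perm (Fin n)) (1 / (B : ℝ)),
      ← Finset.expect_add_distrib]
    refine expect_mono fun σ => ?_
    rw [Inst.totalValue, sum_accepted]
    have hterm : ∀ t, ind (d.1 t (I.view σ t) = true) * I.value (σ t) ≤
        ind (acc t σ ∧ (σ t : ℕ) = 0) + 1 / ((n : ℝ) * B) := by
      intro t
      by_cases h0 : (σ t : ℕ) = 0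
      · have : I.value (σ t) = 1 := by simp [hI, steepInst, h0]
        rw [this, mul_one]
        have h1 : ind (d.1 t (I.view σ t) = true) ≤ ind (acc t σ ∧ (σ t : ℕ) = 0) :=
          ind_mono fun h => ⟨h, h0⟩
        have h2 : 0 ≤ 1 / ((n : ℝ) * B) := by positivity
        linarith
      · have h1 : I.value (σ t) ≤ 1 / ((n : ℝ) * B) := by
          have : I.value (σ t) = ((n : ℝ) - σ t) / ((n : ℝ) ^ 2 * B) := by
            simp [hI, steepInst, h0]
          rw [this, div_le_div_iff₀ (by positivity) (by positivity)]
          have : (0 : ℝ) ≤ ((σ t : ℕ) : ℝ) := Nat.cast_nonneg _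
          nlinarith [mul_nonneg this (mul_pos hn' hB').le]
        have h2 := mul_le_of_le_one_left (I.value_nonneg (σ t))
          (ind_le_one (d.1 t (I.view σ t) = true))
        have h3 := ind_nonneg (acc t σ ∧ (σ t : ℕ) = 0)
        linarith
    refine (Finset.sum_le_sum fun t _ => hterm t).trans ?_
    rw [Finset.sum_add_distrib, Finset.sum_const, Finset.card_univ, Fintype.card_fin,
      nsmul_eq_mul]
    refine add_le_add ?_ (le_of_eq (by field_simp))
    -- Only the round in which item `0` arrives contributes.
    rw [Finset.sum_eq_single (σ.symm ⟨0, hn0⟩)]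
    · exact ind_mono fun h => ⟨_, h⟩
    · intro t _ ht
      refine ind_false fun h => ht ?_
      rw [Equiv.eq_symm_apply]
      exact Fin.ext h.2
    · simp
  have h2 : 𝔼 σ, J.totalValue (d.1.accepted J σ) ≤
      𝔼 σ, ∑ t, ind (acc t σ ∧ ¬ (σ t : ℕ) < L) + 1 := by
    rw [← Fintype.expect_const (ι := Equiv.Perm (Fin n)) (1 : ℝ), ← Finset.expect_add_distrib]
    refine expect_mono fun σ => ?_
    rw [Inst.totalValue, sum_accepted]
    have hterm : ∀ t, ind (d.1 t (J.view σ t) = true) * J.value (σ t) ≤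
        ind (acc t σ ∧ ¬ (σ t : ℕ) < L) + ind (acc t σ ∧ (σ t : ℕ) < L) := by
      intro t
      have hv : J.value (σ t) ≤ 1 := by
        have : (0 : ℝ) ≤ ((σ t : ℕ) : ℝ) / ((n : ℝ) * B) := by positivity
        simp only [hJ, flatInst]
        linarith
      rw [ind_and, ind_and, ind_not, hview]
      have := mul_le_of_le_one_right (ind_nonneg (d.1 t (I.view σ t) = true)) hv
      simp only [hacc]
      linarith
    refine (Finset.sum_le_sum fun t _ => hterm t).trans ?_
    rw [Finset.sum_add_distrib]
    refine add_le_add le_rfl ?_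
    rw [sum_ind]
    have : (Finset.univ.filter fun t => acc t σ ∧ (σ t : ℕ) < L).card ≤ 1 := by
      refine Finset.card_le_one.mpr fun t ht u hu => ?_
      rw [Finset.mem_filter] at ht hu
      exact hfeas σ t u ht.2.1 hu.2.1 ht.2.2
    exact_mod_cast this
  have h1' := mul_le_mul_of_nonneg_left h1 (Real.exp_pos 1).le
  have h2' := div_le_div_of_nonneg_right h2 hB'.le
  rw [add_div] at h2'
  have : (2 * Real.exp 1 + 2) / (B : ℝ) =
      (Real.exp 1 + 1) / B + Real.exp 1 * (1 / B) + 1 / B := by ring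
  linarith

/-- The bound on the competitive ratio for capacity `B`, scaled by `e + 1`. -/
noncomputable def ratioBound (B : ℕ) : ℝ :=
  (1 + (2 * Real.exp 1 + 2) / B + Real.sqrt (2 / B)) * (1 + 1 / B)

theorem tendsto_ratioBound : Filter.Tendsto ratioBound Filter.atTop (nhds 1) := by
  have h1 : ∀ c : ℝ, Filter.Tendsto (fun B : ℕ => c / (B : ℝ)) Filter.atTop (nhds 0) :=
    fun c => tendsto_const_div_atTop_nhds_zero_nat c
  have h2 : Filter.Tendsto (fun B : ℕ => Real.sqrt (2 / B)) Filter.atTop (nhds 0) := by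
    have := (Real.continuous_sqrt.tendsto 0).comp (h1 2)
    rwa [Real.sqrt_zero] at this
  have h3 := (((tendsto_const_nhds (x := (1 : ℝ))).add (h1 (2 * Real.exp 1 + 2))).add h2).mul
    ((tendsto_const_nhds (x := (1 : ℝ))).add (h1 1))
  simp only [add_zero, mul_one] at h3
  exact h3

/-- The instances `steepInst` and `flatInst` force `e ρ + ρ (1 - 1 / B)` to be at most the bound of
`det_tradeoff`. -/
theorem competitive_le (hB : 0 < B) (hn : 2 * B ≤ n) (A : OrdinalAlgorithm B n) {ρ : ℝ}
    (hA : A.IsCompetitive ρ) : ρ ≤ ratioBound B / (Real.exp 1 + 1) := by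
  have hB' : (0 : ℝ) < B := by exact_mod_cast hB
  have he := Real.exp_pos 1
  set K : ℝ := 1 + (2 * Real.exp 1 + 2) / B + Real.sqrt (2 / B) with hK
  have hK0 : 0 < K := by positivity
  have hr : ratioBound B = K * (1 + 1 / B) := rfl
  rw [hr]
  rcases lt_or_ge ρ 0 with hρ | hρ
  · exact hρ.le.trans (by positivity)
  obtain ⟨L, rfl⟩ : ∃ L, n = L + B := ⟨n - B, by omega⟩
  set I := steepInst L B (L + B) hB with hI
  set J := flatInst L B (L + B) hB with hJ
  have hEI := expectedValue_eq A I
  have hEJ := expectedValue_eq A J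
  have h1 : ρ ≤ A.expectedValue I :=
    le_trans (by have := one_le_opt_steep (L := L) (n := L + B) hB (by omega) (by omega); nlinarith)
      (hA I)
  have h2 : ρ * (B - 1) ≤ A.expectedValue J :=
    le_trans (mul_le_mul_of_nonneg_left (le_opt_flat hB rfl) hρ) (hA J)
  have h3 : Real.exp 1 * A.expectedValue I + A.expectedValue J / B ≤ K := by
    calc _ = ∑ d : DetAlgorithm B (L + B), (A d).toReal *
          (Real.exp 1 * 𝔼 σ, I.totalValue (d.1.accepted I σ) +
            (𝔼 σ, J.totalValue (d.1.accepted J σ)) / B) := by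
          rw [hEI, hEJ, Finset.mul_sum, Finset.sum_div, ← Finset.sum_add_distrib]
          exact Finset.sum_congr rfl fun d _ => by ring
      _ ≤ ∑ d : DetAlgorithm B (L + B), (A d).toReal * K :=
          Finset.sum_le_sum fun d _ => mul_le_mul_of_nonneg_left
            (det_tradeoff hB (by omega) rfl d) ENNReal.toReal_nonneg
      _ = K := by rw [← Finset.sum_mul, sum_toReal_eq_one, one_mul]
  have h4 : 0 ≤ A.expectedValue J := by
    rw [hEJ]
    exact Finset.sum_nonneg fun d _ => mul_nonneg ENNReal.toReal_nonneg
      (expect_nonneg fun σ => Finset.sum_nonneg fun i _ => J.value_nonneg i)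
  have h5 : ρ ≤ K := by
    have : 0 ≤ A.expectedValue J / B := by positivity
    have : 1 ≤ Real.exp 1 := Real.one_le_exp zero_le_one
    nlinarith
  have h6 : ρ * (B - 1) / B ≤ A.expectedValue J / B := by gcongr
  have h7 : ρ * (B - 1) / B = ρ - ρ / B := by field_simp
  have h8 : ρ / B ≤ K / B := by gcongr
  have h9 := mul_le_mul_of_nonneg_left h1 he.le
  rw [le_div_iff₀ (by positivity)]
  have : K * (1 + 1 / B) = K + K / B := by ring
  linarith

/-! ### The secretary algorithm on the large items -/

/-- In the view `w`, the `s`-th arrival is large and beats all earlier large arrivals. -/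
def OrdinalView.IsLargeRecord {m : ℕ} (w : OrdinalView m) (s : Fin m) : Prop :=
  w.isLarge s = true ∧ ∀ j, j < s → w.isLarge j = true → w.better s j = true

open Classical in
/-- Accept the first large item, from round `k` on, that beats all earlier large items. -/
noncomputable def secretaryRule (k : ℕ) : DecisionRule n := fun t w =>
  decide (k ≤ (t : ℕ) ∧ w.IsLargeRecord (Fin.last t) ∧
    ∀ s : Fin (t + 1), k ≤ (s : ℕ) → s < Fin.last t → ¬ w.IsLargeRecord s)

/-- The item arriving in round `s` is large and beats all earlier large arrivals. -/
def Inst.LargeRecord (I : Inst B n) (σ : ArrivalOrder n) (s : Fin n) : Prop :=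
  I.isLarge (σ s) = true ∧ ∀ j, j < s → I.isLarge (σ j) = true → σ s < σ j

theorem Inst.isLargeRecord_view (I : Inst B n) (σ : ArrivalOrder n) (t : Fin n)
    (s : Fin (t + 1)) :
    (I.view σ t).IsLargeRecord s ↔ I.LargeRecord σ (Fin.castLE t.isLt s) := by
  unfold OrdinalView.IsLargeRecord Inst.LargeRecord
  simp only [Inst.view_isLarge, Inst.view_better]
  refine and_congr_right fun _ => ⟨fun h j hj => ?_, fun h j hj => h _ hj⟩
  have hjs : (j : ℕ) < s := hj
  have := s.isLt
  exact h ⟨j, by omega⟩ hjs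

theorem secretaryRule_iff (k : ℕ) (I : Inst B n) (σ : ArrivalOrder n) (t : Fin n) :
    secretaryRule k t (I.view σ t) = true ↔ k ≤ (t : ℕ) ∧ I.LargeRecord σ t ∧
      ∀ s : Fin n, k ≤ (s : ℕ) → s < t → ¬ I.LargeRecord σ s := by
  classical
  unfold secretaryRule
  rw [decide_eq_true_iff, Inst.isLargeRecord_view]
  refine and_congr_right fun _ => and_congr_right fun _ => ?_
  simp only [Inst.isLargeRecord_view]
  refine ⟨fun h s hk hs => ?_, fun h s hk hs => h _ hk hs⟩
  have hs' : (s : ℕ) < t := hs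
  exact h ⟨s, by omega⟩ hk hs

theorem secretaryRule_feasible (k : ℕ) (I : Inst B n) (σ : ArrivalOrder n) :
    I.Feasible ((secretaryRule k).accepted I σ) := by
  set S := (secretaryRule k).accepted I σ with hS
  have hmem : ∀ i ∈ S, k ≤ ((σ.symm i : Fin n) : ℕ) ∧ I.LargeRecord σ (σ.symm i) ∧
      ∀ s : Fin n, k ≤ (s : ℕ) → s < σ.symm i → ¬ I.LargeRecord σ s := by
    intro i hi
    rw [hS, ← Equiv.apply_symm_apply σ i, mem_accepted, secretaryRule_iff] at hi
    exact hi
  have hcard : S.card ≤ 1 := by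
    refine Finset.card_le_one.mpr fun i hi j hj => σ.symm.injective ?_
    obtain ⟨hi1, hi2, hi3⟩ := hmem i hi
    obtain ⟨hj1, hj2, hj3⟩ := hmem j hj
    rcases lt_trichotomy (σ.symm i) (σ.symm j) with h | h | h
    · exact absurd hi2 (hj3 _ hi1 h)
    · exact h
    · exact absurd hj2 (hi3 _ hj1 h)
  have hsize : ∀ i ∈ S, I.size i = B := by
    intro i hi
    have := (hmem i hi).2.1.1
    rw [Equiv.apply_symm_apply] at this
    simp [Inst.size, this]
  rw [Inst.Feasible, Finset.sum_congr rfl hsize, Finset.sum_const, smul_eq_mul]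
  exact mul_le_of_le_one_left (Nat.zero_le B) hcard

/-- A priority order on the items, smaller meaning better: large items precede small ones, and
otherwise the items are sorted by rank. -/
def Inst.key (I : Inst B n) (i : Fin n) : ℕ := if I.isLarge i then i else n + i

theorem Inst.key_injective (I : Inst B n) : Function.Injective I.key := by
  intro i j h
  have := i.isLt
  have := j.isLt
  unfold Inst.key at h
  apply Fin.ext
  split_ifs at h <;> omega

/-- Among the first `t` arrivals, the one of round `j` has the best priority. -/
def Inst.Leads (I : Inst B n) (t : Fin n) (σ : ArrivalOrder n) (j : Fin n) : Prop :=
  ∀ i, i < t → I.key (σ j) ≤ I.key (σ i)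

theorem Inst.Leads.eq {I : Inst B n} {t : Fin n} {σ : ArrivalOrder n} {i j : Fin n}
    (hi : I.Leads t σ i) (hj : I.Leads t σ j) (hit : i < t) (hjt : j < t) : i = j :=
  σ.injective (I.key_injective (le_antisymm (hi j hjt) (hj i hit)))

/-- The leader of the first `t` rounds is equally likely to be in each of them, independently of
the item arriving in round `t`. -/
theorem expect_leads (I : Inst B n) (b : Fin n) {t j : Fin n} (hj : j < t) :
    𝔼 σ : ArrivalOrder n, ind (σ t = b) * ind (I.Leads t σ j) = 1 / n / t := by
  classical
  have hsymm : ∀ i, i < t → 𝔼 σ : ArrivalOrder n, ind (σ t = b) * ind (I.Leads t σ i) =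
      𝔼 σ : ArrivalOrder n, ind (σ t = b) * ind (I.Leads t σ j) := by
    intro i hi
    rw [← expect_mul_right (Equiv.swap i j)]
    refine Finset.expect_congr rfl fun σ _ => ?_
    rw [Equiv.Perm.mul_apply, Equiv.swap_apply_of_ne_of_ne hi.ne' hj.ne']
    congr 2
    unfold Inst.Leads
    simp only [Equiv.Perm.mul_apply, Equiv.swap_apply_left]
    refine propext ⟨fun h u hu => ?_, fun h u hu => h _ ?_⟩
    · have hlt : Equiv.swap i j u < t := by
        rw [Equiv.swap_apply_def]; split_ifs <;> assumption
      have := h _ hlt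
      rwa [Equiv.swap_apply_self] at this
    · rw [Equiv.swap_apply_def]; split_ifs <;> assumption
  have hsum : ∑ i ∈ Finset.Iio t, 𝔼 σ : ArrivalOrder n, ind (σ t = b) * ind (I.Leads t σ i) =
      1 / n := by
    rw [← Finset.expect_sum_comm, ← expect_ind_apply_eq t b]
    refine Finset.expect_congr rfl fun σ _ => ?_
    rw [← Finset.mul_sum]
    obtain ⟨u, hu, humin⟩ := Finset.exists_min_image (Finset.Iio t) (fun i => I.key (σ i))
      ⟨j, Finset.mem_Iio.mpr hj⟩
    rw [Finset.mem_Iio] at hu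
    have hul : I.Leads t σ u := fun i hi => humin i (Finset.mem_Iio.mpr hi)
    rw [Finset.sum_eq_single_of_mem u (Finset.mem_Iio.mpr hu), ind_true hul, mul_one]
    intro i hi hne
    exact ind_false fun h => hne (h.eq hul (Finset.mem_Iio.mp hi) hu)
  rw [Finset.sum_congr rfl fun i hi => hsymm i (Finset.mem_Iio.mp hi), Finset.sum_const,
    Fin.card_Iio, nsmul_eq_mul] at hsum
  have ht : (t : ℝ) ≠ 0 := by
    have h : (j : ℕ) < t := hj
    exact_mod_cast (by omega : (t : ℕ) ≠ 0)
  rw [eq_div_iff ht]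
  linarith

theorem secretary_accepts {k : ℕ} {I : Inst B n} {σ : ArrivalOrder n} {b t j : Fin n}
    (hb : I.isLarge b = true) (hbest : ∀ i, I.isLarge i = true → b ≤ i) (hkt : k ≤ (t : ℕ))
    (hjk : (j : ℕ) < k) (ht : σ t = b) (hj : I.Leads t σ j) :
    b ∈ (secretaryRule k).accepted I σ := by
  rw [← ht, mem_accepted, secretaryRule_iff]
  refine ⟨hkt, ⟨by rw [ht]; exact hb, fun i hi hL => ?_⟩, fun s hks hs hrec => ?_⟩
  · rw [ht]
    refine lt_of_le_of_ne (hbest _ hL) fun h => hi.ne (σ.injective ?_)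
    rw [ht, h]
  · have hkey := hj s hs
    have hlt := (σ s).isLt
    unfold Inst.key at hkey
    rw [if_pos hrec.1] at hkey
    split_ifs at hkey with hjL
    · have h1 : σ s < σ j := hrec.2 j (by rw [Fin.lt_def]; omega) hjL
      have h2 : (σ s : ℕ) < σ j := h1
      omega
    · omega

/-- The best large item `b` is accepted in round `t ≥ k` if it arrives then and the leader of the
first `t` rounds belongs to the sample of the first `k` rounds. -/
theorem le_expect_secretary {k : ℕ} {I : Inst B n} {b : Fin n} (hk : k ≤ n)
    (hb : I.isLarge b = true) (hbest : ∀ i, I.isLarge i = true → b ≤ i) :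
    ∑ t ∈ Finset.range n, (if k ≤ t then (k : ℝ) / n * (1 / t) else 0) ≤
      𝔼 σ, ind (b ∈ (secretaryRule k).accepted I σ) := by
  classical
  have hpoint : ∀ σ : ArrivalOrder n,
      ∑ t : Fin n, (if k ≤ (t : ℕ) then
        ∑ j ∈ Finset.univ.filter (fun j : Fin n => (j : ℕ) < k),
          ind (σ t = b) * ind (I.Leads t σ j) else 0) ≤
      ind (b ∈ (secretaryRule k).accepted I σ) := by
    intro σ
    rw [Finset.sum_eq_single (σ.symm b)]
    · split_ifs with hkt
      · rw [← Finset.mul_sum, ind_true (Equiv.apply_symm_apply σ b), one_mul]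
        by_cases hex : ∃ j : Fin n, (j : ℕ) < k ∧ I.Leads (σ.symm b) σ j
        · obtain ⟨j, hjk, hj⟩ := hex
          rw [ind_true (secretary_accepts hb hbest hkt hjk (Equiv.apply_symm_apply σ b) hj),
            sum_ind]
          have : ((Finset.univ.filter fun j : Fin n => (j : ℕ) < k).filter
              fun j => I.Leads (σ.symm b) σ j).card ≤ 1 := by
            refine Finset.card_le_one.mpr fun i hi i' hi' => ?_
            rw [Finset.mem_filter, Finset.mem_filter] at hi hi'
            exact hi.2.eq hi'.2 (by rw [Fin.lt_def]; omega) (by rw [Fin.lt_def]; omega)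
          exact_mod_cast this
        · rw [Finset.sum_eq_zero]
          · exact ind_nonneg _
          · intro j hj
            rw [Finset.mem_filter] at hj
            exact ind_false fun h => hex ⟨j, hj.2, h⟩
      · exact ind_nonneg _
    · intro t _ ht
      have h : ¬ σ t = b := fun h => ht (by rw [← h]; simp)
      simp [ind_false h]
    · simp
  refine le_trans (le_of_eq ?_) (expect_mono hpoint)
  rw [Finset.expect_sum_comm, ← Fin.sum_univ_eq_sum_range
    (fun t => if k ≤ t then (k : ℝ) / n * (1 / t) else 0)]
  refine Finset.sum_congr rfl fun t _ => ?_
  split_ifs with hkt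
  · rw [Finset.expect_sum_comm, Finset.sum_congr rfl (fun j hj => expect_leads I b (t := t) ?_),
      Finset.sum_const, card_filter_val_lt hk, nsmul_eq_mul]
    · ring
    · rw [Finset.mem_filter] at hj
      rw [Fin.lt_def]; omega
  · simp

/-- Trapezoidal lower bound for the harmonic sum. -/
theorem log_le_harmonic {k m : ℕ} (hk : 0 < k) (hm : k ≤ m) :
    Real.log m - Real.log k + (1 / k - 1 / m) / 2 ≤
      ∑ t ∈ Finset.range m, (if k ≤ t then 1 / (t : ℝ) else 0) := by
  induction m, hm using Nat.le_induction with
  | base =>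
    rw [Finset.sum_eq_zero]
    · simp
    · intro t ht
      rw [Finset.mem_range] at ht
      rw [if_neg (by omega)]
  | succ m hm ih =>
    rw [Finset.sum_range_succ, if_pos hm]
    have hm0 : (0 : ℝ) < m := by exact_mod_cast (by omega : 0 < m)
    set u : ℝ := ((m : ℝ) + 1) / m with hu
    have hu0 : 0 < u := by positivity
    have hu1 : 1 ≤ u := by rw [hu, le_div_iff₀ hm0]; linarith
    -- `log u ≤ sinh (log u)` is the trapezoidal rule for `1 / x` on `[m, m + 1]`.
    have h := Real.self_le_sinh_iff.mpr (Real.log_nonneg hu1)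
    rw [Real.sinh_log hu0, hu, Real.log_div (by positivity) hm0.ne'] at h
    have e : (((m : ℝ) + 1) / m - (((m : ℝ) + 1) / m)⁻¹) / 2 =
        1 / m - (1 / m - 1 / ((m : ℝ) + 1)) / 2 := by
      field_simp
      ring
    rw [e] at h
    push_cast
    linarith

/-- The condition is what the error terms require of a sample of size `k ≈ n / e`; the nearest
integer satisfies it for `n ≥ 3`. -/
theorem exists_sample_size (hn : 2 ≤ n) :
    ∃ k : ℕ, 0 < k ∧ k ≤ n ∧ (Real.exp 1 * k - n) ^ 2 ≤ Real.exp 1 * (n - k) / 2 := by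
  have he1 := Real.exp_one_gt_d9
  have he2 := Real.exp_one_lt_d9
  rcases hn.eq_or_lt with rfl | hn
  · refine ⟨1, one_pos, by norm_num, ?_⟩
    push_cast
    nlinarith
  · have hn' : (3 : ℝ) ≤ n := by exact_mod_cast hn
    set x : ℝ := n / Real.exp 1 with hx
    have hxn : Real.exp 1 * x = n := by rw [hx]; field_simp
    have hx1 : 1 < x := by rw [hx, lt_div_iff₀ (by positivity)]; linarith
    have hx2 : x ≤ 0.4 * n := by
      rw [hx, div_le_iff₀ (by positivity)]; nlinarith
    set k := ⌊x + 1 / 2⌋₊ with hk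
    have h1 : (k : ℝ) ≤ x + 1 / 2 := Nat.floor_le (by linarith)
    have h2 : x + 1 / 2 < k + 1 := Nat.lt_floor_add_one _
    have hk0 : 0 < k := Nat.floor_pos.mpr (by linarith)
    refine ⟨k, hk0, ?_, ?_⟩
    · have : (k : ℝ) ≤ n := by linarith
      exact_mod_cast this
    · have e : (Real.exp 1 * k - n) ^ 2 = Real.exp 1 * (Real.exp 1 * (k - x) ^ 2) := by
        rw [← hxn]; ring
      rw [e, mul_div_assoc]
      refine mul_le_mul_of_nonneg_left ?_ (by positivity)
      have h3 : (k - x) ^ 2 ≤ 1 / 4 := by nlinarith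
      nlinarith

/-- With the right sample size, the secretary algorithm succeeds with probability at least `1 / e`
for every number of items: the trapezoidal error of the harmonic sum outweighs the loss from
rounding the sample size. -/
theorem inv_exp_le_secretary {k : ℕ} (hk : 0 < k) (hkn : k ≤ n)
    (h : (Real.exp 1 * k - n) ^ 2 ≤ Real.exp 1 * (n - k) / 2) :
    1 / Real.exp 1 ≤
      ∑ t ∈ Finset.range n, (if k ≤ t then (k : ℝ) / n * (1 / t) else 0) := by
  have he := Real.exp_pos 1
  have hk' : (0 : ℝ) < k := by exact_mod_cast hk
  have hn' : (0 : ℝ) < n := by exact_mod_cast (by omega : 0 < n)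
  have hsum : ∑ t ∈ Finset.range n, (if k ≤ t then (k : ℝ) / n * (1 / t) else 0) =
      (k : ℝ) / n * ∑ t ∈ Finset.range n, (if k ≤ t then 1 / (t : ℝ) else 0) := by
    rw [Finset.mul_sum]
    refine Finset.sum_congr rfl fun t _ => ?_
    split_ifs <;> simp
  rw [hsum]
  refine le_trans ?_ (mul_le_mul_of_nonneg_left (log_le_harmonic hk hkn) (by positivity))
  set y : ℝ := Real.exp 1 * k / n with hy
  have hlog : 2 - y ≤ Real.log n - Real.log k := by
    have := Real.log_le_sub_one_of_pos (x := y) (by positivity)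
    rw [hy, Real.log_div (by positivity) hn'.ne', Real.log_mul he.ne' hk'.ne', Real.log_exp,
      ← hy] at this
    linarith
  have hkn0 : (0 : ℝ) ≤ k / n := by positivity
  refine le_trans ?_ (mul_le_mul_of_nonneg_left (add_le_add hlog le_rfl) hkn0)
  have e : (k : ℝ) / n * (2 - y + (1 / k - 1 / n) / 2) - 1 / Real.exp 1 =
      (Real.exp 1 * (n - k) / 2 - (Real.exp 1 * k - n) ^ 2) / (Real.exp 1 * n ^ 2) := by
    rw [hy]
    field_simp
    ring
  have : 0 ≤ (Real.exp 1 * (n - k) / 2 - (Real.exp 1 * k - n) ^ 2) / (Real.exp 1 * (n : ℝ) ^ 2) :=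
    div_nonneg (by linarith) (by positivity)
  linarith

/-- There is an algorithm that obtains the best large item with probability at least `1 / e`. -/
theorem exists_large_algorithm (B n : ℕ) :
    ∃ d : DetAlgorithm B n, ∀ (I : Inst B n) (b : Fin n), I.isLarge b = true →
      (∀ i, I.isLarge i = true → b ≤ i) →
      1 / Real.exp 1 * I.value b ≤ 𝔼 σ, I.totalValue (d.1.accepted I σ) := by
  obtain ⟨k, hk⟩ : ∃ k : ℕ, ∀ (I : Inst B n) (b : Fin n), I.isLarge b = true →
      (∀ i, I.isLarge i = true → b ≤ i) →
      1 / Real.exp 1 ≤ 𝔼 σ, ind (b ∈ (secretaryRule k).accepted I σ) := by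
    rcases lt_or_ge n 2 with hn | hn
    · refine ⟨0, fun I b hb _ => ?_⟩
      have hmem : ∀ σ : ArrivalOrder n, b ∈ (secretaryRule 0).accepted I σ := by
        intro σ
        have hall : ∀ i j : Fin n, ¬ i < j := fun i j h => by
          have h' : (i : ℕ) < j := h
          have := j.isLt
          omega
        rw [← Equiv.apply_symm_apply σ b, mem_accepted, secretaryRule_iff]
        refine ⟨Nat.zero_le _, ⟨by rw [Equiv.apply_symm_apply]; exact hb, fun j hj => ?_⟩,
          fun s _ hs => ?_⟩
        · exact absurd hj (hall _ _)
        · exact absurd hs (hall _ _)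
      simp only [ind_true (hmem _), Fintype.expect_const]
      rw [div_le_one (Real.exp_pos 1)]
      exact Real.one_le_exp zero_le_one
    · obtain ⟨k, hk0, hkn, hk⟩ := exists_sample_size hn
      exact ⟨k, fun I b hb hbest =>
        (inv_exp_le_secretary hk0 hkn hk).trans (le_expect_secretary hkn hb hbest)⟩
  refine ⟨⟨secretaryRule k, secretaryRule_feasible k⟩, fun I b hb hbest => ?_⟩
  refine (mul_le_mul_of_nonneg_right (hk I b hb hbest) (I.value_nonneg b)).trans ?_
  rw [Finset.expect_mul]
  refine expect_mono fun σ => ?_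
  by_cases h : b ∈ (secretaryRule k).accepted I σ
  · rw [ind_true h, one_mul]
    exact Finset.single_le_sum (f := I.value) (fun i _ => I.value_nonneg i) h
  · rw [ind_false h, zero_mul]
    exact Finset.sum_nonneg fun i _ => I.value_nonneg i

/-! ### The sampling algorithm on the small items -/

open Classical in
/-- In the view `w`, the `s`-th arrival comes after the sample of the first `k` rounds, is small,
and is beaten by fewer than `r` small items of the sample. -/
def OrdinalView.IsCandidate (k : ℕ) (r : ℝ) {m : ℕ} (w : OrdinalView m) (s : Fin m) : Prop :=
  k ≤ (s : ℕ) ∧ w.isLarge s = false ∧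
    ((Finset.univ.filter fun j : Fin m => j < s ∧ (j : ℕ) < k ∧ w.isLarge j = false ∧
      w.better j s = true).card : ℝ) < r

open Classical in
/-- Accept the first `B` candidates. -/
noncomputable def sampleRule (B k : ℕ) (r : ℝ) : DecisionRule n := fun t w =>
  decide (w.IsCandidate k r (Fin.last t) ∧
    (Finset.univ.filter fun s : Fin (t + 1) => s < Fin.last t ∧ w.IsCandidate k r s).card < B)

open Classical in
/-- The item arriving in round `s` comes after the sample of the first `k` rounds, is small, and is
beaten by fewer than `r` small items of the sample. -/
def Inst.Candidate (I : Inst B n) (k : ℕ) (r : ℝ) (σ : ArrivalOrder n) (s : Fin n) : Prop :=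
  k ≤ (s : ℕ) ∧ I.isLarge (σ s) = false ∧
    ((Finset.univ.filter fun j : Fin n => j < s ∧ (j : ℕ) < k ∧ I.isLarge (σ j) = false ∧
      σ j < σ s).card : ℝ) < r

theorem card_filter_castLE {m : ℕ} (h : m ≤ n) (P : Fin n → Prop) (Q : Fin m → Prop)
    [DecidablePred P] [DecidablePred Q] (hPQ : ∀ j, Q j ↔ P (Fin.castLE h j))
    (hP : ∀ j, P j → (j : ℕ) < m) :
    (Finset.univ.filter Q).card = (Finset.univ.filter P).card := by
  have : Finset.univ.filter P = (Finset.univ.filter Q).map (Fin.castLEEmb h) := by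
    ext j
    simp only [Finset.mem_filter, Finset.mem_univ, true_and, Finset.mem_map]
    constructor
    · intro hj
      exact ⟨⟨j, hP j hj⟩, (hPQ _).mpr hj, rfl⟩
    · rintro ⟨i, hi, rfl⟩
      exact (hPQ i).mp hi
  rw [this, Finset.card_map]

theorem Inst.isCandidate_view (I : Inst B n) (k : ℕ) (r : ℝ) (σ : ArrivalOrder n) (t : Fin n)
    (s : Fin (t + 1)) :
    (I.view σ t).IsCandidate k r s ↔ I.Candidate k r σ (Fin.castLE t.isLt s) := by
  classical
  unfold OrdinalView.IsCandidate Inst.Candidate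
  refine and_congr_right fun _ => and_congr_right fun _ => ?_
  rw [card_filter_castLE t.isLt (fun j : Fin n => j < Fin.castLE t.isLt s ∧ (j : ℕ) < k ∧
    I.isLarge (σ j) = false ∧ σ j < σ (Fin.castLE t.isLt s))]
  · intro j
    rw [Inst.view_better, Inst.view_isLarge]
    rfl
  · intro j hj
    have h : (j : ℕ) < s := hj.1
    have := s.isLt
    omega

open Classical in
theorem sampleRule_iff (k : ℕ) (r : ℝ) (I : Inst B n) (σ : ArrivalOrder n) (t : Fin n) :
    sampleRule B k r t (I.view σ t) = true ↔ I.Candidate k r σ t ∧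
      (Finset.univ.filter fun s : Fin n => s < t ∧ I.Candidate k r σ s).card < B := by
  unfold sampleRule
  rw [decide_eq_true_iff, Inst.isCandidate_view]
  refine and_congr_right fun _ => ?_
  rw [card_filter_castLE t.isLt (fun s : Fin n => s < t ∧ I.Candidate k r σ s)]
  · intro s
    rw [Inst.isCandidate_view]
    rfl
  · intro s hs
    have h : (s : ℕ) < t := hs.1
    omega

theorem sampleRule_feasible (k : ℕ) (r : ℝ) (I : Inst B n) (σ : ArrivalOrder n) :
    I.Feasible ((sampleRule B k r).accepted I σ) := by
  classical
  set S := (sampleRule B k r).accepted I σ with hS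
  have hmem : ∀ i ∈ S, I.Candidate k r σ (σ.symm i) ∧
      (Finset.univ.filter fun s : Fin n => s < σ.symm i ∧ I.Candidate k r σ s).card < B := by
    intro i hi
    rw [hS, ← Equiv.apply_symm_apply σ i, mem_accepted, sampleRule_iff] at hi
    exact hi
  have hsize : ∀ i ∈ S, I.size i = 1 := by
    intro i hi
    have := (hmem i hi).1.2.1
    rw [Equiv.apply_symm_apply] at this
    simp [Inst.size, this]
  rw [Inst.Feasible, Finset.sum_congr rfl hsize, Finset.sum_const, smul_eq_mul, mul_one]
  rcases S.eq_empty_or_nonempty with h | h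
  · rw [h]; simp
  -- Compare with the last item that was accepted.
  obtain ⟨x, hx, hmax⟩ := Finset.exists_max_image S σ.symm h
  have hle : (S.erase x).card ≤
      (Finset.univ.filter fun s : Fin n => s < σ.symm x ∧ I.Candidate k r σ s).card := by
    refine Finset.card_le_card_of_injOn σ.symm (fun i hi => ?_) σ.symm.injective.injOn
    have hi' := Finset.mem_erase.mp hi
    simp only [Finset.coe_filter, Finset.mem_univ, true_and, Set.mem_ofPred_eq]
    exact ⟨lt_of_le_of_ne (hmax i hi'.2) fun h => hi'.1 (σ.symm.injective h), (hmem i hi'.2).1⟩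
  have h1 := (hmem x hx).2
  rw [Finset.card_erase_of_mem hx] at hle
  omega

/-- The number of items of `T` among the first `k` arrivals. -/
noncomputable def sampleCount (k : ℕ) (T : Finset (Fin n)) (σ : ArrivalOrder n) : ℝ :=
  ∑ i ∈ T, ind ((σ.symm i : ℕ) < k)

/-- `T` consists of best small items: it contains with any item all better small items. -/
def Inst.IsTop (I : Inst B n) (T : Finset (Fin n)) : Prop :=
  (∀ i ∈ T, I.isLarge i = false) ∧ ∀ i ∈ T, ∀ j, I.isLarge j = false → j < i → j ∈ T

/-- If the sample contains fewer than `r` items of `T` but at least `r` of the at most `B` items of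
`U` (or `U` contains all small items), then all items of `T` outside the sample are accepted: they
are candidates, and all candidates belong to `U`. -/
theorem sample_accepts {k : ℕ} {r : ℝ} {I : Inst B n} {σ : ArrivalOrder n} {T U : Finset (Fin n)}
    (hT : I.IsTop T) (hU : I.IsTop U) (hUB : U.card ≤ B) (hTr : sampleCount k T σ < r)
    (hUr : (∀ i, I.isLarge i = false → i ∈ U) ∨ r ≤ sampleCount k U σ) {i : Fin n}
    (hi : i ∈ T) (hik : k ≤ (σ.symm i : ℕ)) : i ∈ (sampleRule B k r).accepted I σ := by
  classical
  have hcand : I.Candidate k r σ (σ.symm i) := by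
    refine ⟨hik, by rw [Equiv.apply_symm_apply]; exact hT.1 i hi, lt_of_le_of_lt ?_ hTr⟩
    rw [sampleCount, sum_ind]
    have := Finset.card_le_card_of_injOn (s := Finset.univ.filter fun j : Fin n => j < σ.symm i ∧
      (j : ℕ) < k ∧ I.isLarge (σ j) = false ∧ σ j < σ (σ.symm i))
      (t := T.filter fun i => (σ.symm i : ℕ) < k) σ (fun j hj => ?_) σ.injective.injOn
    · exact_mod_cast this
    · simp only [Finset.coe_filter, Finset.mem_univ, true_and, Set.mem_ofPred_eq,
        Equiv.apply_symm_apply] at hj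
      simp only [Finset.coe_filter, Set.mem_ofPred_eq, Equiv.symm_apply_apply]
      exact ⟨hT.2 i hi _ hj.2.2.1 hj.2.2.2, hj.2.1⟩
  have hmemU : ∀ s, I.Candidate k r σ s → σ s ∈ U := by
    rintro s ⟨hks, hsmall, hcount⟩
    rcases hUr with h | h
    · exact h _ hsmall
    · by_contra hsU
      refine absurd (lt_of_lt_of_le hcount h) (not_lt.mpr ?_)
      rw [sampleCount, sum_ind]
      have := Finset.card_le_card_of_injOn (s := U.filter fun i => (σ.symm i : ℕ) < k)
        (t := Finset.univ.filter fun j : Fin n => j < s ∧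
          (j : ℕ) < k ∧ I.isLarge (σ j) = false ∧ σ j < σ s) σ.symm (fun x hx => ?_)
        σ.symm.injective.injOn
      · exact_mod_cast this
      · simp only [Finset.coe_filter, Set.mem_ofPred_eq] at hx
        simp only [Finset.coe_filter, Finset.mem_univ, true_and, Set.mem_ofPred_eq,
          Equiv.apply_symm_apply]
        refine ⟨by rw [Fin.lt_def]; omega, hx.2, hU.1 x hx.1, ?_⟩
        by_contra hle
        rcases (not_lt.mp hle).lt_or_eq with h' | h'
        · exact hsU (hU.2 x hx.1 _ hsmall h')
        · exact hsU (h' ▸ hx.1)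
  rw [← Equiv.apply_symm_apply σ i, mem_accepted, sampleRule_iff]
  refine ⟨hcand, lt_of_lt_of_le ?_ hUB⟩
  have hiU : i ∈ U := by
    have := hmemU _ hcand
    rwa [Equiv.apply_symm_apply] at this
  refine lt_of_le_of_lt (Finset.card_le_card_of_injOn (t := U.erase i) σ (fun s hs => ?_)
    σ.injective.injOn) (Finset.card_erase_lt_of_mem hiU)
  simp only [Finset.coe_filter, Finset.mem_univ, true_and, Set.mem_ofPred_eq] at hs
  rw [Finset.mem_coe, Finset.mem_erase]
  refine ⟨fun h => hs.1.ne ?_, hmemU s hs.2⟩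
  rw [← h, Equiv.symm_apply_apply]

/-- Chebyshev's inequality for the number of items of `T` in the sample. -/
theorem expect_ind_deviation_le {k : ℕ} (hk : k ≤ n) (T : Finset (Fin n)) {g : ℝ} (hg : 0 < g)
    {P : ArrivalOrder n → Prop}
    (hP : ∀ σ, P σ → g ^ 2 ≤ (sampleCount k T σ - (k : ℝ) / n * T.card) ^ 2) :
    𝔼 σ, ind (P σ) ≤ (k : ℝ) / n * T.card / g ^ 2 := by
  rw [le_div_iff₀ (by positivity), Finset.expect_mul]
  refine le_trans (expect_mono fun σ => ?_) (expect_sq_sample_le hk T)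
  by_cases h : P σ
  · rw [ind_true h, one_mul]; exact hP σ h
  · rw [ind_false h, zero_mul]; positivity

theorem exists_top (I : Inst B n) (a : ℕ) :
    ∃ T, I.IsTop T ∧ T.card ≤ a ∧ ((∀ i, I.isLarge i = false → i ∈ T) ∨ T.card = a) := by
  classical
  induction a with
  | zero => exact ⟨∅, ⟨by simp, by simp⟩, by simp, Or.inr (by simp)⟩
  | succ a ih =>
    obtain ⟨T, hT, hcard, hor⟩ := ih
    by_cases hall : ∀ i, I.isLarge i = false → i ∈ T
    · exact ⟨T, hT, by omega, Or.inl hall⟩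
    · have hne : (Finset.univ.filter fun i => I.isLarge i = false ∧ i ∉ T).Nonempty := by
        push Not at hall
        obtain ⟨i, hi⟩ := hall
        exact ⟨i, by simpa using hi⟩
      obtain ⟨x, hx, hmin⟩ := Finset.exists_min_image _ id hne
      simp only [Finset.mem_filter, Finset.mem_univ, true_and, id] at hx hmin
      have hc : T.card = a := hor.resolve_left hall
      refine ⟨insert x T, ⟨?_, ?_⟩, ?_, Or.inr ?_⟩
      · intro i hi
        rcases Finset.mem_insert.mp hi with rfl | hi
        · exact hx.1
        · exact hT.1 i hi
      · intro i hi j hj hji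
        rw [Finset.mem_insert]
        right
        rcases Finset.mem_insert.mp hi with rfl | hi
        · by_contra hjT
          exact absurd hji (not_lt.mpr (hmin j ⟨hj, hjT⟩))
        · exact hT.2 i hi j hj hji
      · rw [Finset.card_insert_of_notMem hx.2, hc]
      · rw [Finset.card_insert_of_notMem hx.2, hc]

/-- The `a` best small items carry a fraction `a / B` of the value of any `B` small items. -/
theorem mul_sum_le_mul_sum_top {I : Inst B n} {a : ℕ} (ha : a ≤ B) {T S : Finset (Fin n)}
    (hT : I.IsTop T) (hTa : (∀ i, I.isLarge i = false → i ∈ T) ∨ T.card = a)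
    (hS : ∀ i ∈ S, I.isLarge i = false) (hSB : S.card ≤ B) :
    (a : ℝ) * ∑ i ∈ S, I.value i ≤ B * ∑ i ∈ T, I.value i := by
  classical
  have ha' : (a : ℝ) ≤ B := by exact_mod_cast ha
  have hT0 : 0 ≤ ∑ i ∈ T, I.value i := Finset.sum_nonneg fun i _ => I.value_nonneg i
  rcases hTa with hall | hcard
  · have : ∑ i ∈ S, I.value i ≤ ∑ i ∈ T, I.value i :=
      Finset.sum_le_sum_of_subset_of_nonneg (fun i hi => hall i (hS i hi))
        fun i _ _ => I.value_nonneg i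
    calc (a : ℝ) * ∑ i ∈ S, I.value i ≤ a * ∑ i ∈ T, I.value i := by gcongr
      _ ≤ _ := by gcongr
  · rcases T.eq_empty_or_nonempty with hTe | hTne
    · have : a = 0 := by rw [← hcard, hTe]; simp
      rw [this]
      simp only [Nat.cast_zero, zero_mul]
      positivity
    · obtain ⟨m, hm, hmax⟩ := Finset.exists_max_image T id hTne
      simp only [id] at hmax
      -- Subtracting the least value `θ` occurring in `T` makes the items outside `T` worthless.
      set θ := I.value m with hθ
      have hθ0 : 0 ≤ θ := I.value_nonneg m
      have h1 : ∀ i ∈ T, 0 ≤ I.value i - θ := fun i hi =>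
        sub_nonneg.mpr (I.value_strictAnti.antitone (hmax i hi))
      have h2 : ∀ i ∈ S, i ∉ T → I.value i - θ ≤ 0 := fun i hi hiT => by
        refine sub_nonpos.mpr (I.value_strictAnti.antitone ?_)
        by_contra hlt
        exact hiT (hT.2 m hm i (hS i hi) (not_le.mp hlt))
      have h3 : ∑ i ∈ S, (I.value i - θ) ≤ ∑ i ∈ T, (I.value i - θ) := by
        calc ∑ i ∈ S, (I.value i - θ) ≤ ∑ i ∈ S.filter (· ∈ T), (I.value i - θ) := by
              rw [← Finset.sum_filter_add_sum_filter_not S (· ∈ T)]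
              have : ∑ i ∈ S.filter (¬ · ∈ T), (I.value i - θ) ≤ 0 :=
                Finset.sum_nonpos fun i hi => by
                  rw [Finset.mem_filter] at hi
                  exact h2 i hi.1 hi.2
              linarith
          _ ≤ _ := Finset.sum_le_sum_of_subset_of_nonneg
              (fun i hi => (Finset.mem_filter.mp hi).2) fun i hi _ => h1 i hi
      have h4 : 0 ≤ ∑ i ∈ T, (I.value i - θ) := Finset.sum_nonneg h1
      rw [Finset.sum_sub_distrib, Finset.sum_sub_distrib, Finset.sum_const, Finset.sum_const,
        nsmul_eq_mul, nsmul_eq_mul, hcard] at h3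
      rw [Finset.sum_sub_distrib, Finset.sum_const, nsmul_eq_mul, hcard] at h4
      have h5 : (S.card : ℝ) * θ ≤ B * θ := by
        have : (S.card : ℝ) ≤ B := by exact_mod_cast hSB
        gcongr
      have ha0 : (0 : ℝ) ≤ a := Nat.cast_nonneg a
      nlinarith [mul_nonneg ha0 (sub_nonneg.mpr h5), mul_nonneg (sub_nonneg.mpr ha') h4]

/-- The expected value of the sampling algorithm in terms of the two failure probabilities. -/
theorem le_expect_sample {k : ℕ} (hk : k ≤ n) {r : ℝ} {I : Inst B n} {T U : Finset (Fin n)}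
    (hT : I.IsTop T) (hU : I.IsTop U) (hUB : U.card ≤ B) {δ₁ δ₂ : ℝ}
    (h₁ : 𝔼 σ : ArrivalOrder n, ind (r ≤ sampleCount k T σ) ≤ δ₁)
    (h₂ : (∀ i, I.isLarge i = false → i ∈ U) ∨
      𝔼 σ : ArrivalOrder n, ind (sampleCount k U σ < r) ≤ δ₂) (hδ₂ : 0 ≤ δ₂) :
    (1 - k / n - δ₁ - δ₂) * ∑ i ∈ T, I.value i ≤
      𝔼 σ, I.totalValue ((sampleRule B k r).accepted I σ) := by
  classical
  set bad : ArrivalOrder n → Prop := fun σ =>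
    ¬ (∀ i, I.isLarge i = false → i ∈ U) ∧ sampleCount k U σ < r with hbad
  have hbadE : 𝔼 σ, ind (bad σ) ≤ δ₂ := by
    rcases h₂ with h | h
    · have : ∀ σ, ind (bad σ) = 0 := fun σ => ind_false fun hb => hb.1 h
      simp only [this, Finset.expect_const_zero]
      exact hδ₂
    · exact (expect_mono fun σ => ind_mono fun hb => hb.2).trans h
  have hpoint : ∀ σ : ArrivalOrder n, ∑ i ∈ T, (1 - ind ((σ.symm i : ℕ) < k) -
      ind (r ≤ sampleCount k T σ) - ind (bad σ)) * I.value i ≤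
      I.totalValue ((sampleRule B k r).accepted I σ) := by
    intro σ
    set A := (sampleRule B k r).accepted I σ with hA
    calc _ ≤ ∑ i ∈ T, ind (i ∈ A) * I.value i := by
          refine Finset.sum_le_sum fun i hi =>
            mul_le_mul_of_nonneg_right ?_ (I.value_nonneg i)
          have n1 := ind_nonneg ((σ.symm i : ℕ) < k)
          have n2 := ind_nonneg (r ≤ sampleCount k T σ)
          have n3 := ind_nonneg (bad σ)
          have n4 := ind_nonneg (i ∈ A)
          by_cases c1 : (σ.symm i : ℕ) < k
          · rw [ind_true c1]; linarith
          by_cases c2 : r ≤ sampleCount k T σ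
          · rw [ind_true c2]; linarith
          by_cases c3 : bad σ
          · rw [ind_true c3]; linarith
          have : i ∈ A := by
            refine sample_accepts hT hU hUB (not_le.mp c2) ?_ hi (not_lt.mp c1)
            by_cases hall : ∀ i, I.isLarge i = false → i ∈ U
            · exact Or.inl hall
            · exact Or.inr (not_lt.mp fun h => c3 ⟨hall, h⟩)
          rw [ind_true this]
          linarith
      _ = ∑ i ∈ T.filter (· ∈ A), I.value i := by
          rw [Finset.sum_filter]
          refine Finset.sum_congr rfl fun i _ => ?_
          split_ifs with h
          · rw [ind_true h, one_mul]
          · rw [ind_false h, zero_mul]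
      _ ≤ ∑ i ∈ A, I.value i := Finset.sum_le_sum_of_subset_of_nonneg
          (fun i hi => (Finset.mem_filter.mp hi).2) fun i _ _ => I.value_nonneg i
  refine le_trans ?_ (expect_mono hpoint)
  rw [Finset.expect_sum_comm, Finset.mul_sum]
  refine Finset.sum_le_sum fun i _ => ?_
  rw [← Finset.expect_mul]
  refine mul_le_mul_of_nonneg_right ?_ (I.value_nonneg i)
  rw [Finset.expect_sub_distrib, Finset.expect_sub_distrib, Finset.expect_sub_distrib,
    Fintype.expect_const,
    expect_ind_symm_lt hk]
  linarith

/-- The scale of the sampling algorithm: about `B ^ (1/4)`. -/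
def sampleScale (B : ℕ) : ℕ := Nat.sqrt (Nat.sqrt B)

theorem sampleScale_pos (hB : 0 < B) : 0 < sampleScale B :=
  Nat.sqrt_pos.mpr (Nat.sqrt_pos.mpr hB)

theorem sampleScale_pow_le (B : ℕ) : sampleScale B ^ 4 ≤ B := by
  have h1 := Nat.sqrt_le' (Nat.sqrt B)
  have h2 := Nat.sqrt_le' B
  calc sampleScale B ^ 4 = (Nat.sqrt (Nat.sqrt B) ^ 2) ^ 2 := by rw [sampleScale]; ring
    _ ≤ Nat.sqrt B ^ 2 := Nat.pow_le_pow_left h1 2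
    _ ≤ B := h2

theorem half_le_nat_div {m c : ℕ} (hc : 0 < c) (hm : c ≤ m) :
    (m : ℝ) / (2 * c) ≤ ((m / c : ℕ) : ℝ) := by
  have h1 := Nat.lt_div_mul_add hc (a := m)
  have h2 : 1 ≤ m / c := (Nat.one_le_div_iff hc).mpr hm
  have h3 : m ≤ m / c * (2 * c) := by nlinarith
  rw [div_le_iff₀ (by positivity)]
  exact_mod_cast h3

/-- There is an algorithm that obtains almost the value of the best `B` small items. -/
theorem exists_small_algorithm (hB : 0 < B) (n : ℕ) :
    ∃ d : DetAlgorithm B n, ∀ (I : Inst B n) (S : Finset (Fin n)),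
      (∀ i ∈ S, I.isLarge i = false) → S.card ≤ B →
      (1 - 66 / (sampleScale B : ℝ)) * ∑ i ∈ S, I.value i ≤
        𝔼 σ, I.totalValue (d.1.accepted I σ) := by
  classical
  set c := sampleScale B with hc
  have hc0 : 0 < c := sampleScale_pos hB
  have hc' : (0 : ℝ) < c := by exact_mod_cast hc0
  have hB' : (0 : ℝ) < B := by exact_mod_cast hB
  rcases le_or_gt n B with hn | hn
  · -- All small items fit, so no sample is needed.
    refine ⟨⟨sampleRule B 0 1, sampleRule_feasible 0 1⟩, fun I S hS _ => ?_⟩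
    set T := Finset.univ.filter fun i => I.isLarge i = false with hT
    have hmem : ∀ i, I.isLarge i = false → i ∈ T := fun i hi => by simpa [hT] using hi
    have htop : I.IsTop T := ⟨fun i hi => by simpa [hT] using hi, fun _ _ j hj _ => hmem j hj⟩
    have hcard : T.card ≤ B := (Finset.card_le_univ T).trans (by simpa using hn)
    have h := le_expect_sample (k := 0) (r := 1) (δ₁ := 0) (δ₂ := 0) (Nat.zero_le n) htop htop hcard
      (by simp [sampleCount, ind_false, not_le.mpr (zero_lt_one (α := ℝ))]) (Or.inl hmem) le_rfl
    simp only [Nat.cast_zero, zero_div, sub_zero, one_mul] at h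
    refine le_trans ?_ h
    have h1 : ∑ i ∈ S, I.value i ≤ ∑ i ∈ T, I.value i :=
      Finset.sum_le_sum_of_subset_of_nonneg (fun i hi => hmem i (hS i hi))
        fun i _ _ => I.value_nonneg i
    have h2 : 0 ≤ ∑ i ∈ S, I.value i := Finset.sum_nonneg fun i _ => I.value_nonneg i
    have h3 : (0 : ℝ) ≤ 66 / c := by positivity
    nlinarith
  · have hcB : c ≤ B := (Nat.le_self_pow (by norm_num) c).trans (sampleScale_pow_le B)
    have hn' : (0 : ℝ) < n := by exact_mod_cast (by omega : 0 < n)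
    set k := n / c with hk
    set b := B / c with hb
    set a := B - b with ha
    have hkn : k ≤ n := Nat.div_le_self n c
    have hbB : b ≤ B := Nat.div_le_self B c
    set p : ℝ := (k : ℝ) / n with hp
    set r : ℝ := p * ((a + B : ℝ) / 2) with hr
    have hab : (a : ℝ) = B - b := by rw [ha, Nat.cast_sub hbB]
    have hp1 : p ≤ 1 / c := by
      rw [hp, div_le_div_iff₀ hn' hc', one_mul]
      exact_mod_cast Nat.div_mul_le_self n c
    have hp2 : 1 / (2 * c) ≤ p := by
      have := half_le_nat_div hc0 (by omega : c ≤ n)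
      rw [hp, div_le_div_iff₀ (by positivity) hn', one_mul]
      rwa [div_le_iff₀ (by positivity)] at this
    have hb1 : (b : ℝ) / B ≤ 1 / c := by
      rw [div_le_div_iff₀ hB' hc', one_mul]
      exact_mod_cast Nat.div_mul_le_self B c
    have hb2 : (B : ℝ) / (2 * c) ≤ b := half_le_nat_div hc0 hcB
    have hp0 : 0 < p := lt_of_lt_of_le (by positivity) hp2
    have hb0 : (0 : ℝ) < b := lt_of_lt_of_le (by positivity) hb2
    have hg : 0 < p * b / 2 := by positivity
    -- The failure probabilities given by Chebyshev's inequality.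
    have hfail : p * B / (p * b / 2) ^ 2 ≤ 32 / c := by
      have h1 : p * B / (p * b / 2) ^ 2 = 4 * B / (p * b ^ 2) := by field_simp; norm_num
      have h2 : (B : ℝ) ^ 2 / (8 * c ^ 3) ≤ p * b ^ 2 := by
        calc (B : ℝ) ^ 2 / (8 * c ^ 3) = 1 / (2 * c) * ((B : ℝ) / (2 * c)) ^ 2 := by
              field_simp; norm_num
          _ ≤ p * b ^ 2 := by gcongr
      have h4 : (c : ℝ) ^ 4 ≤ B := by exact_mod_cast sampleScale_pow_le B
      rw [h1]
      calc 4 * (B : ℝ) / (p * b ^ 2) ≤ 4 * B / ((B : ℝ) ^ 2 / (8 * c ^ 3)) := by gcongr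
        _ = 32 * (c : ℝ) ^ 3 / B := by field_simp; norm_num
        _ ≤ 32 * (c : ℝ) ^ 3 / (c : ℝ) ^ 4 := by gcongr
        _ = 32 / (c : ℝ) := by field_simp
    refine ⟨⟨sampleRule B k r, sampleRule_feasible k r⟩, fun I S hS hSB => ?_⟩
    obtain ⟨T, hT, hTa, hTor⟩ := exists_top I a
    obtain ⟨U, hU, hUB, hUor⟩ := exists_top I B
    have hTa' : (T.card : ℝ) ≤ a := by exact_mod_cast hTa
    have hd1 : 𝔼 σ : ArrivalOrder n, ind (r ≤ sampleCount k T σ) ≤ 32 / c := by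
      refine (expect_ind_deviation_le hkn T hg fun σ hσ => ?_).trans (le_trans ?_ hfail)
      · rw [← hp]
        have h1 : p * T.card ≤ p * a := by gcongr
        have h2 : p * b / 2 ≤ sampleCount k T σ - p * T.card := by
          have : r - p * a = p * b / 2 := by rw [hr, hab]; ring
          linarith
        exact pow_le_pow_left₀ hg.le h2 2
      · have : (T.card : ℝ) ≤ B := by linarith
        gcongr
    have hd2 : (∀ i, I.isLarge i = false → i ∈ U) ∨
        𝔼 σ : ArrivalOrder n, ind (sampleCount k U σ < r) ≤ 32 / c := by
      refine hUor.imp_right fun hcard => ?_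
      refine (expect_ind_deviation_le hkn U hg fun σ hσ => ?_).trans (le_trans ?_ hfail)
      · rw [← hp, hcard]
        have h2 : p * b / 2 ≤ p * B - sampleCount k U σ := by
          have : p * B - r = p * b / 2 := by rw [hr, hab]; ring
          linarith
        rw [← neg_sub, neg_sq]
        exact pow_le_pow_left₀ hg.le h2 2
      · rw [hcard]
    have hmain := le_expect_sample hkn hT hU hUB hd1 hd2 (by positivity)
    rw [← hp] at hmain
    have htop := mul_sum_le_mul_sum_top (Nat.sub_le B b) hT hTor hS hSB
    have hS0 : 0 ≤ ∑ i ∈ S, I.value i := Finset.sum_nonneg fun i _ => I.value_nonneg i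
    have hT0 : 0 ≤ ∑ i ∈ T, I.value i := Finset.sum_nonneg fun i _ => I.value_nonneg i
    set X := ∑ i ∈ S, I.value i
    set Y := ∑ i ∈ T, I.value i
    set u : ℝ := 1 / c with hu
    have hu0 : 0 < u := by positivity
    have e32 : (32 : ℝ) / c = 32 * u := by rw [hu]; ring
    have e66 : (66 : ℝ) / c = 66 * u := by rw [hu]; ring
    rw [e32] at hmain
    rw [e66]
    have hE0 : 0 ≤ 𝔼 σ, I.totalValue ((sampleRule B k r).accepted I σ) :=
      expect_nonneg fun σ => Finset.sum_nonneg fun i _ => I.value_nonneg i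
    have hXY : (1 - u) * X ≤ Y := by
      have h1 : (a : ℝ) / B * X ≤ Y := by
        rw [div_mul_eq_mul_div, div_le_iff₀ hB']; linarith
      have h2 : (a : ℝ) / B = 1 - b / B := by rw [hab]; field_simp
      have h3 : 1 - u ≤ (a : ℝ) / B := by rw [h2]; linarith
      exact (mul_le_mul_of_nonneg_right h3 hS0).trans h1
    rcases le_or_gt 1 (65 * u) with h | h
    · exact le_trans (mul_nonpos_of_nonpos_of_nonneg (by linarith) hS0) hE0
    · calc (1 - 66 * u) * X ≤ (1 - 65 * u) * ((1 - u) * X) := by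
            nlinarith [mul_nonneg (mul_nonneg hu0.le hu0.le) hS0]
        _ ≤ (1 - 65 * u) * Y := mul_le_mul_of_nonneg_left hXY (by linarith)
        _ ≤ (1 - p - 32 * u - 32 * u) * Y := mul_le_mul_of_nonneg_right (by linarith) hT0
        _ ≤ _ := hmain

/-! ### Mixing the two algorithms -/

/-- The algorithm that runs `d₁` with probability `p` and `d₂` otherwise. -/
theorem exists_mixture (d₁ d₂ : DetAlgorithm B n) {p : ℝ} (hp0 : 0 ≤ p) (hp1 : p ≤ 1) :
    ∃ A : OrdinalAlgorithm B n, ∀ I : Inst B n, A.expectedValue I =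
      p * 𝔼 σ, I.totalValue (d₁.1.accepted I σ) +
        (1 - p) * 𝔼 σ, I.totalValue (d₂.1.accepted I σ) := by
  classical
  set w : DetAlgorithm B n → ℝ := fun d =>
    (if d = d₁ then p else 0) + (if d = d₂ then 1 - p else 0) with hw
  have hw0 : ∀ d, 0 ≤ w d := fun d => by
    have : 0 ≤ 1 - p := by linarith
    simp only [hw]
    positivity
  have hsum : ∑ d, w d = 1 := by
    simp only [hw, Finset.sum_add_distrib, Finset.sum_ite_eq', Finset.mem_univ, if_true]
    ring
  refine ⟨PMF.ofFintype (fun d => ENNReal.ofReal (w d)) ?_, fun I => ?_⟩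
  · rw [← ENNReal.ofReal_sum_of_nonneg fun d _ => hw0 d, hsum, ENNReal.ofReal_one]
  · rw [expectedValue_eq]
    simp only [PMF.ofFintype_apply, ENNReal.toReal_ofReal (hw0 _)]
    simp only [hw, add_mul, ite_mul, zero_mul, Finset.sum_add_distrib, Finset.sum_ite_eq',
      Finset.mem_univ, if_true]

/-- An optimal packing consists of a single large item or of at most `B` small items. -/
theorem opt_cases (hB : 0 < B) (I : Inst B n) :
    (∃ b, I.isLarge b = true ∧ (∀ i, I.isLarge i = true → b ≤ i) ∧ I.opt ≤ I.value b) ∨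
      ∃ S : Finset (Fin n), (∀ i ∈ S, I.isLarge i = false) ∧ S.card ≤ B ∧
        I.opt = ∑ i ∈ S, I.value i := by
  classical
  obtain ⟨S, hS, hopt⟩ := Finset.exists_mem_eq_sup' (s := Finset.univ.filter I.Feasible)
    ⟨∅, by simp [I.feasible_empty]⟩ I.totalValue
  have hopt' : I.opt = I.totalValue S := hopt
  have hfeas : ∑ i ∈ S, I.size i ≤ B := (Finset.mem_filter.mp hS).2
  by_cases hL : ∃ x ∈ S, I.isLarge x = true
  · left
    obtain ⟨x, hxS, hx⟩ := hL
    have hSx : S = {x} := by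
      refine Finset.eq_singleton_iff_unique_mem.mpr ⟨hxS, fun y hy => ?_⟩
      by_contra hne
      have hsub : ({x, y} : Finset (Fin n)) ⊆ S := by
        intro i hi
        rw [Finset.mem_insert, Finset.mem_singleton] at hi
        rcases hi with rfl | rfl <;> assumption
      have h := Finset.sum_le_sum_of_subset (f := I.size) hsub
      rw [Finset.sum_pair (Ne.symm hne)] at h
      have h1 : I.size x = B := by simp [Inst.size, hx]
      have h2 : 1 ≤ I.size y := by unfold Inst.size; split_ifs <;> omega
      omega
    obtain ⟨b, hb, hmin⟩ := Finset.exists_min_image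
      (Finset.univ.filter fun i => I.isLarge i = true) id ⟨x, by simpa using hx⟩
    simp only [Finset.mem_filter, Finset.mem_univ, true_and, id] at hb hmin
    refine ⟨b, hb, hmin, ?_⟩
    rw [hopt', hSx, Inst.totalValue, Finset.sum_singleton]
    exact I.value_strictAnti.antitone (hmin x hx)
  · right
    have hsmall : ∀ i ∈ S, I.isLarge i = false := fun i hi => by
      rw [← Bool.not_eq_true]
      exact fun h => hL ⟨i, hi, h⟩
    refine ⟨S, hsmall, ?_, hopt'⟩
    have hsize : ∀ i ∈ S, I.size i = 1 := fun i hi => by simp [Inst.size, hsmall i hi]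
    rwa [Finset.sum_congr rfl hsize, Finset.sum_const, smul_eq_mul, mul_one] at hfeas

theorem tendsto_sampleScale : Filter.Tendsto sampleScale Filter.atTop Filter.atTop := by
  refine Filter.tendsto_atTop.mpr fun m => ?_
  filter_upwards [Filter.eventually_ge_atTop ((m * m) * (m * m))] with B hB
  exact Nat.le_sqrt.mpr (Nat.le_sqrt.mpr hB)

/-- The mixing weights `e / (e + 1)` and `1 / (e + 1)` balance the success probability `1 / e` on
large items against the ratio `1 - o(1)` on small ones. -/
theorem exists_competitive (hB : 0 < B) (n : ℕ) :
    ∃ A : OrdinalAlgorithm B n,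
      A.IsCompetitive (1 / (Real.exp 1 + 1) - 66 / (sampleScale B : ℝ)) := by
  have he := Real.exp_pos 1
  obtain ⟨d₁, h₁⟩ := exists_large_algorithm B n
  obtain ⟨d₂, h₂⟩ := exists_small_algorithm hB n
  obtain ⟨A, hA⟩ := exists_mixture d₁ d₂ (p := Real.exp 1 / (Real.exp 1 + 1)) (by positivity)
    (by rw [div_le_one (by positivity)]; linarith)
  have hq : 1 - Real.exp 1 / (Real.exp 1 + 1) = 1 / (Real.exp 1 + 1) := by field_simp; ring
  rw [hq] at hA
  refine ⟨A, fun I => ?_⟩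
  have hopt : 0 ≤ I.opt := by
    have := I.le_opt I.feasible_empty
    simpa [Inst.totalValue] using this
  have hδ : 0 ≤ 66 / (sampleScale B : ℝ) := by positivity
  have hE : ∀ d : DetAlgorithm B n, 0 ≤ 𝔼 σ, I.totalValue (d.1.accepted I σ) := fun d =>
    expect_nonneg fun σ => Finset.sum_nonneg fun i _ => I.value_nonneg i
  rw [hA]
  rcases opt_cases hB I with ⟨b, hb, hmin, hle⟩ | ⟨S, hS, hcard, heq⟩
  · have h := mul_le_mul_of_nonneg_left (h₁ I b hb hmin)
      (by positivity : 0 ≤ Real.exp 1 / (Real.exp 1 + 1))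
    have h' : Real.exp 1 / (Real.exp 1 + 1) * (1 / Real.exp 1 * I.value b) =
        1 / (Real.exp 1 + 1) * I.value b := by field_simp
    have h2 : 0 ≤ 1 / (Real.exp 1 + 1) * 𝔼 σ, I.totalValue (d₂.1.accepted I σ) :=
      mul_nonneg (by positivity) (hE d₂)
    have h3 : 1 / (Real.exp 1 + 1) * I.opt ≤ 1 / (Real.exp 1 + 1) * I.value b := by gcongr
    nlinarith [mul_nonneg hδ hopt]
  · have h := h₂ I S hS hcard
    rw [← heq] at h
    have h' := mul_le_mul_of_nonneg_left h (by positivity : 0 ≤ 1 / (Real.exp 1 + 1))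
    have h2 : 0 ≤ Real.exp 1 / (Real.exp 1 + 1) * 𝔼 σ, I.totalValue (d₁.1.accepted I σ) :=
      mul_nonneg (by positivity) (hE d₁)
    have hle : 1 / (Real.exp 1 + 1) ≤ 1 := by
      rw [div_le_one (by positivity)]; linarith
    have h3 : 1 / (Real.exp 1 + 1) * (66 / (sampleScale B : ℝ) * I.opt) ≤
        66 / (sampleScale B : ℝ) * I.opt :=
      mul_le_of_le_one_left (mul_nonneg hδ hopt) hle
    linarith

end KnapsackSecretary

theorem mainTheorem2 :
    (∃ (A : (B n : ℕ) → KnapsackSecretary.OrdinalAlgorithm B n) (δ : ℕ → ℝ),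
      Filter.Tendsto δ Filter.atTop (nhds 0) ∧
      ∀ B : ℕ, 2 ≤ B → ∀ n : ℕ,
        (A B n).IsCompetitive (1 / (Real.exp 1 + 1) - δ B)) ∧
    (∃ δ : ℕ → ℝ,
      Filter.Tendsto δ Filter.atTop (nhds 0) ∧
      ∀ B : ℕ, 2 ≤ B → ∀ n : ℕ, 2 * B ≤ n →
        ∀ (A : KnapsackSecretary.OrdinalAlgorithm B n) (ρ : ℝ),
          A.IsCompetitive ρ → ρ ≤ 1 / (Real.exp 1 + 1) + δ B) := by
  constructor
  · have hex : ∀ B n : ℕ, ∃ A : KnapsackSecretary.OrdinalAlgorithm B n, 2 ≤ B →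
        A.IsCompetitive (1 / (Real.exp 1 + 1) - 66 / (KnapsackSecretary.sampleScale B : ℝ)) := by
      intro B n
      by_cases hB : 2 ≤ B
      · obtain ⟨A, hA⟩ := KnapsackSecretary.exists_competitive (by omega : 0 < B) n
        exact ⟨A, fun _ => hA⟩
      · exact ⟨PMF.pure ⟨_, KnapsackSecretary.secretaryRule_feasible 0⟩, fun h => absurd h hB⟩
    choose A hA using hex
    refine ⟨A, fun B => 66 / (KnapsackSecretary.sampleScale B : ℝ), ?_, fun B hB n => hA B n hB⟩
    exact (tendsto_const_div_atTop_nhds_zero_nat 66).comp KnapsackSecretary.tendsto_sampleScale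
  · refine ⟨fun B => (KnapsackSecretary.ratioBound B - 1) / (Real.exp 1 + 1), ?_,
      fun B hB n hn A ρ hA => ?_⟩
    · have h := (KnapsackSecretary.tendsto_ratioBound.sub_const 1).div_const (Real.exp 1 + 1)
      simpa using h
    · have h := KnapsackSecretary.competitive_le (by omega) hn A hA
      have e : 1 / (Real.exp 1 + 1) + (KnapsackSecretary.ratioBound B - 1) / (Real.exp 1 + 1) =
          KnapsackSecretary.ratioBound B / (Real.exp 1 + 1) := by ring
      rw [e]
      exact h
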